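/- Let $A>0$, $\gamma>1$, $\tau_\Pi>0$ and $\zeta>0$ be constants, put $P(\rho)=A\rho^\gamma$ and $c_s=\sqrt{P'(\rho)}$, and consider on $\mathbb{R}^3$ the system for the density $\rho$, the velocity $\mathbf v=(v^1,v^2,v^3)$ and the bulk stress $\Pi$ (repeated indices are summed) \[ \partial_t\rho+\partial_i(\rho v^i)=0, \] \[ \rho\,\partial_t v_i+\rho\,v^k\partial_k v_i+c_s^2\,\partial_i\rho+\partial_i\Pi=0\quad(i=1,2,3), \] \[ \tau_\Pi\,\partial_t\Pi+\tau_\Pi\,\partial_i(v^i\Pi)+\Pi+\zeta\,\partial_i v^i=0. \] Let $(\rho,\mathbf v,\Pi)$ be a $C^1$ solution on $[0,T_0]\times\mathbb{R}^3$ for some $T_0>0$, with initial values $(\rho^0,\mathbf v^0,\Pi^0)$ at $t=0$. Suppose that $\rho^0(\mathbf x)>0$ for all $\mathbf x$ and that, for some $R>0$ and some constant $\bar\rho>0$, one has $\rho^0(\mathbf x)=\bar\rho$, $\mathbf v^0(\mathbf x)=0$ and $\Pi^0(\mathbf x)=0$ whenever $|\mathbf x|\ge R$. Put \[ \bar c_v=\sqrt{A\gamma\bar\rho^{\,\gamma-1}+\frac{\zeta}{\bar\rho\,\tau_\Pi}}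 \] and suppose that \[ \int_{\mathbb{R}^3}(\rho^0-\bar\rho)\,d\mathbf x\ge 0,\qquad \int_{\mathbb{R}^3}\Pi^0\,d\mathbf x\ge 0,\qquad \int_{\mathbb{R}^3}\mathbf x\cdot\rho^0\mathbf v^0\,d\mathbf x>\frac{16\pi}{3}\,\bar c_v\,R^4\,\max_{\mathbf x\in\mathbb{R}^3}\rho^0(\mathbf x). \] Then the lifespan of $(\rho,\mathbf v,\Pi)$ is finite, where the lifespan is the supremum of all $T>0$ such that the system has a $C^1$ solution on $[0,T]\times\mathbb{R}^3$ with initial values $(\rho^0,\mathbf v^0,\Pi^0)$ at $t=0$. -/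

import Mathlib

open Set MeasureTheory
open scoped ENNReal

noncomputable section

namespace BulkViscous

/-- Physical space `ℝ³` with its Euclidean norm and Lebesgue measure. -/
abbrev E3 : Type := EuclideanSpace ℝ (Fin 3)

/-- The spatial partial derivative `∂ᵢ f` at `x`. -/
def partialX (i : Fin 3) (f : E3 → ℝ) (x : E3) : ℝ :=
  fderiv ℝ f x (EuclideanSpace.single i 1)

/-- The divergence `∂ᵢ uⁱ` at `x`. -/
def divX (u : E3 → E3) (x : E3) : ℝ :=
  ∑ i : Fin 3, partialX i (fun y => u y i) x

/-- The time derivative `∂ₜ f` at `(t, x)` of a function given on `[0, T] × ℝ³`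
(one-sided at the two end points). -/
def partialT (T : ℝ) (f : ℝ → E3 → ℝ) (t : ℝ) (x : E3) : ℝ :=
  derivWithin (fun s => f s x) (Icc 0 T) t

/-- The equation of state `P(r) = A r ^ γ`. -/
def pressure (A γ r : ℝ) : ℝ := A * r ^ γ

/-- The speed of sound `c_s = √(∂P/∂ρ)`. -/
def soundSpeed (A γ r : ℝ) : ℝ := Real.sqrt (deriv (pressure A γ) r)

/-- The speed of the front `√(c_s(ρbar)² + ζ / (ρbar τ))`. -/
def frontSpeed (A γ τ ζ ρbar : ℝ) : ℝ :=
  Real.sqrt (soundSpeed A γ ρbar ^ 2 + ζ / (ρbar * τ))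

/-- `(ρ, v, bulk)` is a `C¹` solution on `[0, T] × ℝ³` of the bulk-viscous system with
equation of state `P = A ρ ^ γ`, relaxation time `τ` and bulk viscosity `ζ`; `bulk` is the bulk
stress. No sign of `ρ` at positive times is imposed. -/
structure IsC1Solution (A γ τ ζ T : ℝ)
    (ρ : ℝ → E3 → ℝ) (v : ℝ → E3 → E3) (bulk : ℝ → E3 → ℝ) : Prop where
  contDiffOn_density :
    ContDiffOn ℝ 1 (fun p : ℝ × E3 => ρ p.1 p.2) (Icc 0 T ×ˢ univ)
  contDiffOn_velocity :
    ContDiffOn ℝ 1 (fun p : ℝ × E3 => v p.1 p.2) (Icc 0 T ×ˢ univ)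
  contDiffOn_bulk :
    ContDiffOn ℝ 1 (fun p : ℝ × E3 => bulk p.1 p.2) (Icc 0 T ×ˢ univ)
  mass : ∀ t ∈ Icc 0 T, ∀ x : E3,
    partialT T ρ t x + divX (fun y => ρ t y • v t y) x = 0
  momentum : ∀ t ∈ Icc 0 T, ∀ x : E3, ∀ i : Fin 3,
    ρ t x * partialT T (fun s y => v s y i) t x
      + ρ t x * ∑ k : Fin 3, v t x k * partialX k (fun y => v t y i) x
      + soundSpeed A γ (ρ t x) ^ 2 * partialX i (ρ t) x
      + partialX i (bulk t) x = 0
  relaxation : ∀ t ∈ Icc 0 T, ∀ x : E3,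
    τ * partialT T bulk t x + τ * divX (fun y => bulk t y • v t y) x
      + bulk t x + ζ * divX (v t) x = 0

/-- The lifespan of the data `(ρ₀, v₀, bulk₀)`: the supremum in `[0, ∞]` of all `T > 0` such that
the system has a `C¹` solution on `[0, T]` with these data at time `0`. -/
def lifespan (A γ τ ζ : ℝ) (ρ₀ : E3 → ℝ) (v₀ : E3 → E3) (bulk₀ : E3 → ℝ) : ℝ≥0∞ :=
  sSup (ENNReal.ofReal '' {T : ℝ | 0 < T ∧
    ∃ (ρ : ℝ → E3 → ℝ) (v : ℝ → E3 → E3) (bulk : ℝ → E3 → ℝ),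
      IsC1Solution A γ τ ζ T ρ v bulk ∧ ρ 0 = ρ₀ ∧ v 0 = v₀ ∧ bulk 0 = bulk₀})

/-- `F(t) = ∫ xᵢ ρ vⁱ dx`. -/
def radialMomentum (ρ : ℝ → E3 → ℝ) (v : ℝ → E3 → E3) (t : ℝ) : ℝ :=
  ∫ x : E3, ∑ i : Fin 3, x i * (ρ t x * v t x i)

/-- `ΔM(t) = ∫ (ρ - ρbar) dx`. -/
def relativeMass (ρbar : ℝ) (ρ : ℝ → E3 → ℝ) (t : ℝ) : ℝ :=
  ∫ x : E3, (ρ t x - ρbar)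

/-- `G(t) = ∫ Π dx`. -/
def bulkIntegral (bulk : ℝ → E3 → ℝ) (t : ℝ) : ℝ :=
  ∫ x : E3, bulk t x

end BulkViscous

end

/-!
The blow-up is that of the radial momentum `F(t) = ∫ x · ρv dx`, in the manner of Sideris.

*Finite speed of propagation.* Outside the ball of radius `R + c t`, where `c` is the front speed
of the rest state `(ρbar, 0, 0)`, the solution stays at rest. With the derivatives of the solution
taken as known bounded functions, the perturbation of the rest state solves the system linearised
at rest up to an error bounded by the perturbation itself (`energy_balance_le`). So the
hyperbolicity of the system away from the rest state, which may fail where `ζ + τ Π < 0` or at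
vacuum, plays no role. The linearised energy flux is at most `c` times the energy density
(`abs_flux_le`), and an energy estimate weighted by a `C¹` function that vanishes outside a
backward cone of speed `c` gives `IsC1Solution.eq_rest_outside`.

*The functionals.* All perturbations now have compact support, so balance laws can be integrated
(`integrable_and_hasDerivAt_integral_of_balance`). The density stays nonnegative, the relative mass
is conserved, `∫ Π` decays exponentially and so keeps its sign, and
`F' = ∫ (ρ |v|² + 3 (P(ρ) - P(ρbar)) + 3 Π)`. The last two terms have nonnegative integrals, the
pressure term by convexity of `P` and nonnegativity of the relative mass. By Cauchy–Schwarz and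
conservation of mass, `F² ≤ κ (R + c t)⁵ ∫ ρ |v|²` with `κ = (4π/3) max ρ(0, ·)`
(`le_integral_momentum_source`).

*Blow-up.* From `F' ≥ F² / (κ (R + c t)⁵)` the function `1 / F - (R + c t)⁻⁴ / (4 c κ)` is
nonincreasing. Since `F(0) > 4 c κ R⁴`, it starts at a negative value `-δ`, and `1 / F > 0` then
forces `(R + c t)⁻⁴ > 4 c κ δ`, which bounds the existence time (`le_of_riccati`).
-/

namespace BulkViscous

/-! ### Partial derivatives on a space-time slab -/

/-- A function on `[0, T] × ℝ³` that is `C¹` up to the two end times. -/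
def IsC1Slab (T : ℝ) (f : ℝ → E3 → ℝ) : Prop :=
  ContDiffOn ℝ 1 (fun p : ℝ × E3 => f p.1 p.2) (Icc 0 T ×ˢ univ)

theorem IsC1Slab.contDiff {T : ℝ} {f : ℝ → E3 → ℝ} (hf : IsC1Slab T f) {t : ℝ}
    (ht : t ∈ Icc 0 T) : ContDiff ℝ 1 (f t) := by
  have h : ContDiffOn ℝ 1 (fun x : E3 => (t, x)) univ := by fun_prop
  exact contDiffOn_univ.1 (ContDiffOn.comp (g := fun p : ℝ × E3 => f p.1 p.2) hf h
    fun x _ => ⟨ht, mem_univ x⟩)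

theorem IsC1Slab.differentiable {T : ℝ} {f : ℝ → E3 → ℝ} (hf : IsC1Slab T f) {t : ℝ}
    (ht : t ∈ Icc 0 T) : Differentiable ℝ (f t) :=
  (hf.contDiff ht).differentiable one_ne_zero

theorem uniqueDiffOn_slab {T : ℝ} (hT : 0 < T) :
    UniqueDiffOn ℝ (Icc 0 T ×ˢ (univ : Set E3)) :=
  (uniqueDiffOn_Icc hT).prod uniqueDiffOn_univ

theorem IsC1Slab.hasFDerivWithinAt {T : ℝ} {f : ℝ → E3 → ℝ} (hf : IsC1Slab T f) {t : ℝ}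
    (ht : t ∈ Icc 0 T) (x : E3) :
    HasFDerivWithinAt (fun p : ℝ × E3 => f p.1 p.2)
      (fderivWithin ℝ (fun p : ℝ × E3 => f p.1 p.2) (Icc 0 T ×ˢ univ) (t, x))
      (Icc 0 T ×ˢ univ) (t, x) :=
  (hf.differentiableOn one_ne_zero (t, x) ⟨ht, mem_univ x⟩).hasFDerivWithinAt

theorem IsC1Slab.hasDerivWithinAt {T : ℝ} {f : ℝ → E3 → ℝ} (hf : IsC1Slab T f) {t : ℝ}
    (ht : t ∈ Icc 0 T) (x : E3) :
    HasDerivWithinAt (fun s => f s x)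
      (fderivWithin ℝ (fun p : ℝ × E3 => f p.1 p.2) (Icc 0 T ×ˢ univ) (t, x) (1, 0))
      (Icc 0 T) t := by
  have h : HasDerivWithinAt (fun s : ℝ => (s, x)) ((1 : ℝ), (0 : E3)) (Icc 0 T) t :=
    (hasDerivWithinAt_id t _).prodMk (hasDerivWithinAt_const t _ x)
  have hmaps : MapsTo (fun s : ℝ => (s, x)) (Icc 0 T) (Icc 0 T ×ˢ univ) :=
    fun s hs => ⟨hs, mem_univ x⟩
  exact (hf.hasFDerivWithinAt ht x).comp_hasDerivWithinAt t h hmaps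

theorem IsC1Slab.partialT_eq_fderivWithin {T : ℝ} {f : ℝ → E3 → ℝ} (hf : IsC1Slab T f)
    (hT : 0 < T) {t : ℝ} (ht : t ∈ Icc 0 T) (x : E3) :
    partialT T f t x =
      fderivWithin ℝ (fun p : ℝ × E3 => f p.1 p.2) (Icc 0 T ×ˢ univ) (t, x) (1, 0) :=
  (hf.hasDerivWithinAt ht x).derivWithin (uniqueDiffOn_Icc hT t ht)

theorem IsC1Slab.partialX_eq_fderivWithin {T : ℝ} {f : ℝ → E3 → ℝ} (hf : IsC1Slab T f)
    {t : ℝ} (ht : t ∈ Icc 0 T) (i : Fin 3) (x : E3) :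
    partialX i (f t) x =
      fderivWithin ℝ (fun p : ℝ × E3 => f p.1 p.2) (Icc 0 T ×ˢ univ) (t, x)
        (0, EuclideanSpace.single i 1) := by
  have h : HasFDerivWithinAt (fun y : E3 => (t, y)) (ContinuousLinearMap.inr ℝ ℝ E3) univ x :=
    (hasFDerivAt_prodMk_right t x).hasFDerivWithinAt
  have h2 := (hf.hasFDerivWithinAt ht x).comp x h fun y _ => ⟨ht, mem_univ y⟩
  rw [hasFDerivWithinAt_univ] at h2
  have h3 : fderiv ℝ (f t) x = _ := h2.fderiv
  simp [partialX, h3]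

theorem IsC1Slab.hasDerivAt_partialT {T : ℝ} {f : ℝ → E3 → ℝ} (hf : IsC1Slab T f) {t : ℝ}
    (ht : t ∈ Ioo 0 T) (x : E3) : HasDerivAt (fun s => f s x) (partialT T f t x) t := by
  have h := hf.hasDerivWithinAt (Ioo_subset_Icc_self ht) x
  rw [← hf.partialT_eq_fderivWithin (ht.1.trans ht.2) (Ioo_subset_Icc_self ht)] at h
  exact h.hasDerivAt (Icc_mem_nhds ht.1 ht.2)

theorem partialT_eq_of_hasDerivAt {T : ℝ} {f : ℝ → E3 → ℝ} {t : ℝ} (ht : t ∈ Ioo 0 T) {x : E3}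
    {f' : ℝ} (h : HasDerivAt (fun s => f s x) f' t) : partialT T f t x = f' := by
  rw [partialT, derivWithin_of_mem_nhds (Icc_mem_nhds ht.1 ht.2), h.deriv]

theorem IsC1Slab.mono {T T' : ℝ} {f : ℝ → E3 → ℝ} (hf : IsC1Slab T f) (hT : T' ≤ T) :
    IsC1Slab T' f :=
  ContDiffOn.mono hf (prod_mono (Icc_subset_Icc_right hT) Subset.rfl)

theorem IsC1Slab.partialT_mono {T T' : ℝ} {f : ℝ → E3 → ℝ} (hf : IsC1Slab T f) (hT' : 0 < T')
    (hT : T' ≤ T) {t : ℝ} (ht : t ∈ Icc 0 T') (x : E3) : partialT T' f t x = partialT T f t x := by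
  rw [hf.partialT_eq_fderivWithin (hT'.trans_le hT) ⟨ht.1, ht.2.trans hT⟩]
  exact ((hf.hasDerivWithinAt ⟨ht.1, ht.2.trans hT⟩ x).mono
    (Icc_subset_Icc_right hT)).derivWithin (uniqueDiffOn_Icc hT' t ht)

theorem IsC1Slab.continuous_partialT {T : ℝ} {f : ℝ → E3 → ℝ} (hf : IsC1Slab T f) {t : ℝ}
    (hT : 0 < T) (ht : t ∈ Icc 0 T) : Continuous (fun x => partialT T f t x) := by
  have h := ContDiffOn.continuousOn_fderivWithin hf (uniqueDiffOn_slab hT) le_rfl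
  have h2 : ContinuousOn (fun x : E3 => (t, x)) univ := by fun_prop
  have h3 := continuousOn_univ.1 (h.comp h2 fun x _ => ⟨ht, mem_univ x⟩)
  have h4 : (fun x => partialT T f t x) = fun x =>
      fderivWithin ℝ (fun p : ℝ × E3 => f p.1 p.2) (Icc 0 T ×ˢ univ) (t, x) (1, 0) :=
    funext fun x => hf.partialT_eq_fderivWithin hT ht x
  rw [h4]
  exact h3.clm_apply continuous_const

theorem IsC1Slab.continuousOn {T : ℝ} {f : ℝ → E3 → ℝ} (hf : IsC1Slab T f) :
    ContinuousOn (fun p : ℝ × E3 => f p.1 p.2) (Icc 0 T ×ˢ univ) :=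
  ContDiffOn.continuousOn hf

/-- On a compact set, a `C¹` function and its first partial derivatives are bounded uniformly in
time, up to the end times. -/
theorem IsC1Slab.exists_bound {T : ℝ} {f : ℝ → E3 → ℝ} (hf : IsC1Slab T f) (hT : 0 < T)
    {K : Set E3} (hK : IsCompact K) :
    ∃ C, 0 ≤ C ∧ ∀ t ∈ Icc 0 T, ∀ x ∈ K, |f t x| ≤ C ∧ |partialT T f t x| ≤ C ∧
      ∀ i, |partialX i (f t) x| ≤ C := by
  have hc : IsCompact (Icc (0 : ℝ) T ×ˢ K) := isCompact_Icc.prod hK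
  have hsub : Icc (0 : ℝ) T ×ˢ K ⊆ Icc 0 T ×ˢ univ := prod_mono Subset.rfl (subset_univ K)
  obtain ⟨C₁, h₁⟩ := hc.exists_bound_of_continuousOn (hf.continuousOn.mono hsub)
  obtain ⟨C₂, h₂⟩ := hc.exists_bound_of_continuousOn
    ((ContDiffOn.continuousOn_fderivWithin hf (uniqueDiffOn_slab hT) le_rfl).mono hsub)
  refine ⟨|C₁| + |C₂|, by positivity, fun t ht x hx => ⟨?_, ?_, fun i => ?_⟩⟩
  · have := h₁ (t, x) ⟨ht, hx⟩
    rw [Real.norm_eq_abs] at this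
    linarith [le_abs_self C₁, abs_nonneg C₂]
  · have h := h₂ (t, x) ⟨ht, hx⟩
    rw [hf.partialT_eq_fderivWithin hT ht]
    have h3 := ContinuousLinearMap.le_opNorm (fderivWithin ℝ (fun p : ℝ × E3 => f p.1 p.2)
      (Icc 0 T ×ˢ univ) (t, x)) (1, 0)
    have h4 : ‖((1 : ℝ), (0 : E3))‖ = 1 := by simp [Prod.norm_def]
    rw [h4, mul_one, Real.norm_eq_abs] at h3
    linarith [le_abs_self C₂, abs_nonneg C₁]
  · have h := h₂ (t, x) ⟨ht, hx⟩
    rw [hf.partialX_eq_fderivWithin ht]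
    have h3 := ContinuousLinearMap.le_opNorm (fderivWithin ℝ (fun p : ℝ × E3 => f p.1 p.2)
      (Icc 0 T ×ˢ univ) (t, x)) (0, EuclideanSpace.single i 1)
    have h4 : ‖((0 : ℝ), (EuclideanSpace.single i 1 : E3))‖ = 1 := by simp [Prod.norm_def]
    rw [h4, mul_one, Real.norm_eq_abs] at h3
    linarith [le_abs_self C₂, abs_nonneg C₁]

theorem IsC1Slab.add {T : ℝ} {f g : ℝ → E3 → ℝ} (hf : IsC1Slab T f) (hg : IsC1Slab T g) :
    IsC1Slab T fun t x => f t x + g t x :=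
  ContDiffOn.add hf hg

theorem IsC1Slab.mul {T : ℝ} {f g : ℝ → E3 → ℝ} (hf : IsC1Slab T f) (hg : IsC1Slab T g) :
    IsC1Slab T fun t x => f t x * g t x :=
  ContDiffOn.mul hf hg

theorem IsC1Slab.sum {T : ℝ} {f : Fin 3 → ℝ → E3 → ℝ} (hf : ∀ i, IsC1Slab T (f i)) :
    IsC1Slab T fun t x => ∑ i, f i t x :=
  ContDiffOn.sum fun i _ => hf i

theorem IsC1Slab.sub_const {T : ℝ} {f : ℝ → E3 → ℝ} (hf : IsC1Slab T f) (c : ℝ) :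
    IsC1Slab T fun t x => f t x - c :=
  ContDiffOn.sub hf contDiffOn_const

theorem IsC1Slab.const_mul {T : ℝ} {f : ℝ → E3 → ℝ} (c : ℝ) (hf : IsC1Slab T f) :
    IsC1Slab T fun t x => c * f t x :=
  ContDiffOn.mul contDiffOn_const hf

theorem IsC1Slab.pow {T : ℝ} {f : ℝ → E3 → ℝ} (hf : IsC1Slab T f) (n : ℕ) :
    IsC1Slab T fun t x => f t x ^ n :=
  ContDiffOn.pow hf n

theorem IsC1Slab.comp {T : ℝ} {f : ℝ → E3 → ℝ} {φ : ℝ → ℝ} (hφ : ContDiff ℝ 1 φ)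
    (hf : IsC1Slab T f) : IsC1Slab T fun t x => φ (f t x) :=
  hφ.comp_contDiffOn hf

theorem isC1Slab_of_contDiff {f : ℝ → E3 → ℝ}
    (hf : ContDiff ℝ 1 fun p : ℝ × E3 => f p.1 p.2) (T : ℝ) : IsC1Slab T f :=
  hf.contDiffOn

section PartialX

variable {i : Fin 3} {f g : E3 → ℝ} {x : E3}

theorem partialX_add (hf : DifferentiableAt ℝ f x) (hg : DifferentiableAt ℝ g x) :
    partialX i (fun y => f y + g y) x = partialX i f x + partialX i g x := by
  simp [partialX, fderiv_fun_add hf hg]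

theorem partialX_mul (hf : DifferentiableAt ℝ f x) (hg : DifferentiableAt ℝ g x) :
    partialX i (fun y => f y * g y) x = f x * partialX i g x + g x * partialX i f x := by
  simp [partialX, fderiv_fun_mul hf hg]

theorem partialX_sum {F : Fin 3 → E3 → ℝ} (hF : ∀ j, DifferentiableAt ℝ (F j) x) :
    partialX i (fun y => ∑ j, F j y) x = ∑ j, partialX i (F j) x := by
  simp [partialX, fderiv_fun_sum fun j _ => hF j]

theorem partialX_const (c : ℝ) : partialX i (fun _ => c) x = 0 := by
  simp [partialX]

theorem partialX_sub_const (c : ℝ) : partialX i (fun y => f y - c) x = partialX i f x := by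
  rw [partialX, partialX, fderiv_sub_const]

theorem partialX_comp {φ : ℝ → ℝ} {φ' : ℝ} (hφ : HasDerivAt φ φ' (f x))
    (hf : DifferentiableAt ℝ f x) : partialX i (fun y => φ (f y)) x = φ' * partialX i f x := by
  have h := (hφ.comp_hasFDerivAt x hf.hasFDerivAt).fderiv
  have h' : fderiv ℝ (fun y => φ (f y)) x = φ' • fderiv ℝ f x := h
  simp [partialX, h']

theorem partialX_coord (k : Fin 3) :
    partialX i (fun y : E3 => y k) x = if k = i then 1 else 0 := by
  have h : fderiv ℝ (fun y : E3 => y k) x = (EuclideanSpace.proj k : E3 →L[ℝ] ℝ) :=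
    (EuclideanSpace.proj k : E3 →L[ℝ] ℝ).hasFDerivAt.fderiv
  simp [partialX, h]

end PartialX

theorem continuous_partialX {f : E3 → ℝ} (hf : ContDiff ℝ 1 f) (i : Fin 3) :
    Continuous (partialX i f) :=
  (hf.continuous_fderiv one_ne_zero).clm_apply continuous_const

theorem partialX_eq_zero_of_eqOn_compl {f : E3 → ℝ} {K : Set E3} (hK : IsClosed K)
    (hf : ∀ x ∉ K, f x = 0) (i : Fin 3) {x : E3} (hx : x ∉ K) : partialX i f x = 0 := by
  have h : f =ᶠ[nhds x] fun _ => 0 := by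
    filter_upwards [hK.isOpen_compl.mem_nhds hx] with y hy using hf y hy
  rw [partialX, h.fderiv_eq]
  simp

theorem integrable_of_eqOn_compl {f : E3 → ℝ} {K : Set E3} (hK : IsCompact K)
    (hf : Continuous f) (hfK : ∀ x ∉ K, f x = 0) : Integrable f :=
  hf.integrable_of_hasCompactSupport (HasCompactSupport.intro hK hfK)

/-! ### Integrated balance laws -/

theorem integral_partialX_eq_zero {f : E3 → ℝ} {K : Set E3} (hK : IsCompact K)
    (hf : ContDiff ℝ 1 f) (hfK : ∀ x ∉ K, f x = 0) (i : Fin 3) : ∫ x, partialX i f x = 0 := by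
  have h1 := integrable_of_eqOn_compl hK hf.continuous hfK
  have h2 := integrable_of_eqOn_compl hK (continuous_partialX hf i)
    fun x hx => partialX_eq_zero_of_eqOn_compl hK.isClosed hfK i hx
  have h := integral_mul_fderiv_eq_neg_fderiv_mul_of_integrable (μ := (volume : Measure E3))
    (f := fun _ => (1 : ℝ)) (g := f) (v := EuclideanSpace.single i 1) (by simp)
    (by simpa using! h2) (by simpa using h1) (fun x _ => by fun_prop)
    (fun x _ => hf.differentiable one_ne_zero x)
  simpa [partialX] using h

theorem IsC1Slab.continuousOn_integral {T : ℝ} {f : ℝ → E3 → ℝ} (hf : IsC1Slab T f)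
    {K : Set E3} (hK : IsCompact K) (hfK : ∀ t ∈ Icc 0 T, ∀ x ∉ K, f t x = 0) :
    ContinuousOn (fun t => ∫ x, f t x) (Icc 0 T) :=
  continuousOn_integral_of_compact_support hK hf.continuousOn fun t x ht hx => hfK t ht x hx

/-- If `∂ₜ η + ∂ₖ qᵏ = s` with `η` and the flux `q` supported in a fixed compact set, then
`d/dt ∫ η = ∫ s`. -/
theorem integrable_and_hasDerivAt_integral_of_balance {T : ℝ} {K : Set E3} (hK : IsCompact K)
    {η : ℝ → E3 → ℝ} {q : Fin 3 → E3 → ℝ} {s : E3 → ℝ} {t : ℝ} (ht : t ∈ Ioo 0 T)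
    (hη : IsC1Slab T η) (hηK : ∀ t ∈ Icc 0 T, ∀ x ∉ K, η t x = 0)
    (hq : ∀ k, ContDiff ℝ 1 (q k)) (hqK : ∀ k, ∀ x ∉ K, q k x = 0)
    (hs : ∀ x, partialT T η t x + ∑ k, partialX k (q k) x = s x) :
    Integrable s ∧ HasDerivAt (fun t => ∫ x, η t x) (∫ x, s x) t := by
  have hT : 0 < T := ht.1.trans ht.2
  obtain ⟨C, -, hC⟩ := hη.exists_bound hT hK
  have hzero : ∀ t ∈ Ioo 0 T, ∀ x ∉ K, partialT T η t x = 0 := by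
    intro t ht x hx
    refine partialT_eq_of_hasDerivAt ht ((hasDerivAt_const t (0 : ℝ)).congr_of_eventuallyEq ?_)
    filter_upwards [Icc_mem_nhds ht.1 ht.2] with u hu using hηK u hu x hx
  have hmain := hasDerivAt_integral_of_dominated_loc_of_deriv_le (μ := (volume : Measure E3))
    (F := η) (F' := partialT T η) (x₀ := t) (bound := K.indicator fun _ => C)
    (Ioo_mem_nhds ht.1 ht.2)
    (by
      filter_upwards [Icc_mem_nhds ht.1 ht.2] with u hu
      exact (hη.contDiff hu).continuous.aestronglyMeasurable)
    (integrable_of_eqOn_compl hK (hη.contDiff (Ioo_subset_Icc_self ht)).continuous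
      (hηK t (Ioo_subset_Icc_self ht)))
    (hη.continuous_partialT hT (Ioo_subset_Icc_self ht)).aestronglyMeasurable
    (by
      refine Filter.Eventually.of_forall fun x u hu => ?_
      by_cases hx : x ∈ K
      · simpa [hx] using (hC u (Ioo_subset_Icc_self hu) x hx).2.1
      · simp [hx, hzero u hu x hx])
    ((integrable_indicator_iff hK.measurableSet).2 (integrableOn_const hK.measure_ne_top))
    (Filter.Eventually.of_forall fun x u hu => hη.hasDerivAt_partialT hu x)
  have hqi : ∀ k, Integrable (partialX k (q k)) := fun k =>
    integrable_of_eqOn_compl hK (continuous_partialX (hq k) k)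
      fun x hx => partialX_eq_zero_of_eqOn_compl hK.isClosed (hqK k) k hx
  have hint : Integrable s := by
    simp_rw [← funext hs]
    exact hmain.1.add (integrable_finsetSum _ fun k _ => hqi k)
  have hsum : ∫ x, s x = ∫ x, partialT T η t x := by
    simp_rw [← hs]
    rw [integral_add hmain.1 (integrable_finsetSum _ fun k _ => hqi k),
      integral_finsetSum _ fun k _ => hqi k]
    simp [fun k => integral_partialX_eq_zero hK (hq k) (hqK k) k]
  rw [hsum]
  exact ⟨hint, hmain.2⟩

/-! ### Auxiliary one-variable calculus -/

/-- A form of Grönwall's inequality. -/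
theorem nonpos_of_deriv_le_mul {T C : ℝ} {E E' : ℝ → ℝ} (hc : ContinuousOn E (Icc 0 T))
    (hd : ∀ t ∈ Ioo 0 T, HasDerivAt E (E' t) t) (hle : ∀ t ∈ Ioo 0 T, E' t ≤ C * E t)
    (h0 : E 0 ≤ 0) {t : ℝ} (ht : t ∈ Icc 0 T) : E t ≤ 0 := by
  have hanti : AntitoneOn (fun t => Real.exp (-(C * t)) * E t) (Icc 0 T) := by
    have hder : ∀ t ∈ Ioo 0 T, HasDerivAt (fun t => Real.exp (-(C * t)) * E t)
        (Real.exp (-(C * t)) * -(C * 1) * E t + Real.exp (-(C * t)) * E' t) t := fun t ht =>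
      (((hasDerivAt_id t).const_mul C).neg.exp).mul (hd t ht)
    refine antitoneOn_of_deriv_nonpos (convex_Icc 0 T)
      ((by fun_prop : Continuous fun t => Real.exp (-(C * t))).continuousOn.mul hc) ?_ ?_
    · rw [interior_Icc]
      exact fun t ht => (hder t ht).differentiableAt.differentiableWithinAt
    · rw [interior_Icc]
      intro t ht
      rw [(hder t ht).deriv]
      nlinarith [hle t ht, Real.exp_pos (-(C * t))]
  have h := hanti ⟨le_rfl, ht.1.trans ht.2⟩ ht ht.1
  simp only [mul_zero, neg_zero, Real.exp_zero, one_mul] at h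
  by_contra! hcon
  linarith [mul_pos (Real.exp_pos (-(C * t))) hcon]

theorem hasDerivAt_max_zero_sq (s : ℝ) :
    HasDerivAt (fun u : ℝ => max u 0 ^ 2) (2 * max s 0) s := by
  rcases lt_trichotomy s 0 with hs | rfl | hs
  · have h : (fun u : ℝ => max u 0 ^ 2) =ᶠ[nhds s] fun _ => 0 := by
      filter_upwards [Iio_mem_nhds hs] with u hu
      simp [max_eq_right (le_of_lt (show u < 0 from hu))]
    simpa [max_eq_right hs.le] using (hasDerivAt_const s (0 : ℝ)).congr_of_eventuallyEq h
  · rw [hasDerivAt_iff_isLittleO]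
    simp only [sub_zero, max_self, mul_zero, smul_eq_mul]
    have h1 : (fun u : ℝ => max u 0 ^ 2 - 0 ^ 2) =O[nhds 0] fun u : ℝ => u ^ 2 := by
      refine Asymptotics.IsBigO.of_bound 1 (Filter.Eventually.of_forall fun u => ?_)
      rw [Real.norm_eq_abs, Real.norm_eq_abs, one_mul]
      rcases le_total u 0 with hu | hu
      · simp [max_eq_right hu, sq_nonneg]
      · simp [max_eq_left hu]
    have h2 : (fun u : ℝ => u ^ 2) =o[nhds 0] fun u : ℝ => u := by
      simpa using Asymptotics.isLittleO_pow_pow (𝕜 := ℝ) (m := 1) (n := 2) (by norm_num)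
    simpa using h1.trans_isLittleO h2
  · have h : (fun u : ℝ => max u 0 ^ 2) =ᶠ[nhds s] fun u => u ^ 2 := by
      filter_upwards [Ioi_mem_nhds hs] with u hu
      simp [max_eq_left (le_of_lt (show 0 < u from hu))]
    simpa [max_eq_left hs.le] using (hasDerivAt_pow 2 s).congr_of_eventuallyEq h

theorem contDiff_max_zero_sq : ContDiff ℝ 1 fun u : ℝ => max u 0 ^ 2 := by
  rw [contDiff_one_iff_deriv]
  refine ⟨fun s => (hasDerivAt_max_zero_sq s).differentiableAt, ?_⟩
  rw [show deriv (fun u : ℝ => max u 0 ^ 2) = fun s => 2 * max s 0 from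
    funext fun s => (hasDerivAt_max_zero_sq s).deriv]
  fun_prop

/-! ### The system in components -/

section Solution

variable {A γ τ ζ T : ℝ} {ρ : ℝ → E3 → ℝ} {v : ℝ → E3 → E3} {bulk : ℝ → E3 → ℝ}

theorem IsC1Solution.density (h : IsC1Solution A γ τ ζ T ρ v bulk) : IsC1Slab T ρ :=
  h.contDiffOn_density

theorem IsC1Solution.bulkStress (h : IsC1Solution A γ τ ζ T ρ v bulk) : IsC1Slab T bulk :=
  h.contDiffOn_bulk

theorem IsC1Solution.velocity (h : IsC1Solution A γ τ ζ T ρ v bulk) (i : Fin 3) :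
    IsC1Slab T fun t x => v t x i :=
  contDiffOn_euclidean.1 h.contDiffOn_velocity i

theorem IsC1Solution.mono (h : IsC1Solution A γ τ ζ T ρ v bulk) {T' : ℝ} (hT' : 0 < T')
    (hT : T' ≤ T) : IsC1Solution A γ τ ζ T' ρ v bulk where
  contDiffOn_density := h.density.mono hT
  contDiffOn_velocity := h.contDiffOn_velocity.mono (prod_mono (Icc_subset_Icc_right hT) Subset.rfl)
  contDiffOn_bulk := h.bulkStress.mono hT
  mass t ht x := by
    rw [h.density.partialT_mono hT' hT ht]
    exact h.mass t ⟨ht.1, ht.2.trans hT⟩ x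
  momentum t ht x i := by
    rw [(h.velocity i).partialT_mono hT' hT ht]
    exact h.momentum t ⟨ht.1, ht.2.trans hT⟩ x i
  relaxation t ht x := by
    rw [h.bulkStress.partialT_mono hT' hT ht]
    exact h.relaxation t ⟨ht.1, ht.2.trans hT⟩ x

theorem divX_smul {f : E3 → ℝ} {u : E3 → E3} {x : E3} (hf : DifferentiableAt ℝ f x)
    (hu : ∀ k, DifferentiableAt ℝ (fun y => u y k) x) :
    divX (fun y => f y • u y) x =
      ∑ k, (f x * partialX k (fun y => u y k) x + u x k * partialX k f x) := by
  simp only [divX, PiLp.smul_apply, smul_eq_mul]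
  exact Finset.sum_congr rfl fun k _ => partialX_mul hf (hu k)

theorem IsC1Solution.mass_expanded (h : IsC1Solution A γ τ ζ T ρ v bulk) {t : ℝ}
    (ht : t ∈ Icc 0 T) (x : E3) :
    partialT T ρ t x + ∑ k, (ρ t x * partialX k (fun y => v t y k) x
      + v t x k * partialX k (ρ t) x) = 0 := by
  rw [← divX_smul (h.density.differentiable ht x) fun k => (h.velocity k).differentiable ht x]
  exact h.mass t ht x

theorem IsC1Solution.relaxation_expanded (h : IsC1Solution A γ τ ζ T ρ v bulk) {t : ℝ}
    (ht : t ∈ Icc 0 T) (x : E3) :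
    τ * partialT T bulk t x + τ * ∑ k, (bulk t x * partialX k (fun y => v t y k) x
      + v t x k * partialX k (bulk t) x) + bulk t x
      + ζ * ∑ k, partialX k (fun y => v t y k) x = 0 := by
  rw [← divX_smul (h.bulkStress.differentiable ht x) fun k => (h.velocity k).differentiable ht x]
  exact h.relaxation t ht x

end Solution

/-! ### The equation of state -/

theorem hasDerivAt_pressure {A γ : ℝ} (hγ : 1 < γ) (r : ℝ) :
    HasDerivAt (pressure A γ) (A * (γ * r ^ (γ - 1))) r :=
  (Real.hasDerivAt_rpow_const (Or.inr hγ.le)).const_mul A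

theorem soundSpeed_sq {A γ : ℝ} (hγ : 1 < γ) (r : ℝ) :
    soundSpeed A γ r ^ 2 = max (A * (γ * r ^ (γ - 1))) 0 := by
  rw [soundSpeed, (hasDerivAt_pressure hγ r).deriv, Real.sq_sqrt']

theorem soundSpeed_sq_of_nonneg {A γ r : ℝ} (hA : 0 < A) (hγ : 1 < γ) (hr : 0 ≤ r) :
    soundSpeed A γ r ^ 2 = A * (γ * r ^ (γ - 1)) := by
  rw [soundSpeed_sq hγ, max_eq_left]
  have := Real.rpow_nonneg hr (γ - 1)
  positivity

/-- On a bounded set `c_s²` differs from its value at `ρbar` by at most a multiple of the distance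
to `ρbar`. Only differentiability at `ρbar` is used: `c_s²` need not be Lipschitz near the
vacuum. -/
theorem exists_soundSpeed_sq_sub_le {A γ ρbar : ℝ} (hA : 0 < A) (hγ : 1 < γ) (hρ : 0 < ρbar)
    (B : ℝ) : ∃ L, 0 ≤ L ∧ ∀ r, |r| ≤ B →
      |soundSpeed A γ r ^ 2 - soundSpeed A γ ρbar ^ 2| ≤ L * |r - ρbar| := by
  set h : ℝ → ℝ := fun r => soundSpeed A γ r ^ 2 with hh
  have hcont : Continuous h := by
    have : h = fun r => max (A * (γ * r ^ (γ - 1))) 0 := funext fun r => soundSpeed_sq hγ r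
    rw [this]
    have h1 : Continuous fun r : ℝ => r ^ (γ - 1) := Real.continuous_rpow_const (by linarith)
    fun_prop
  have hdiff : DifferentiableAt ℝ h ρbar := by
    have h1 : HasDerivAt (fun r : ℝ => A * (γ * r ^ (γ - 1))) _ ρbar :=
      ((Real.hasDerivAt_rpow_const (Or.inl hρ.ne')).const_mul γ).const_mul A
    refine (h1.congr_of_eventuallyEq ?_).differentiableAt
    filter_upwards [Ioi_mem_nhds hρ] with r hr
    exact soundSpeed_sq_of_nonneg hA hγ (le_of_lt hr)
  have hds : Continuous (dslope h ρbar) := by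
    rw [← continuousOn_univ, continuousOn_dslope Filter.univ_mem]
    exact ⟨hcont.continuousOn, hdiff⟩
  obtain ⟨L, hL⟩ := (isCompact_Icc (a := -B) (b := B)).exists_bound_of_continuousOn
    hds.continuousOn
  refine ⟨|L|, abs_nonneg L, fun r hr => ?_⟩
  have h1 := sub_smul_dslope h ρbar r
  have h2 := hL r (abs_le.1 hr)
  change |h r - h ρbar| ≤ _
  rw [← h1, smul_eq_mul, abs_mul, mul_comm]
  rw [Real.norm_eq_abs] at h2
  exact mul_le_mul_of_nonneg_right (h2.trans (le_abs_self L)) (abs_nonneg _)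

theorem frontSpeed_sq {A γ τ ζ ρbar : ℝ} (hτ : 0 < τ) (hζ : 0 < ζ) (hρ : 0 < ρbar) :
    frontSpeed A γ τ ζ ρbar ^ 2 = soundSpeed A γ ρbar ^ 2 + ζ / (ρbar * τ) :=
  Real.sq_sqrt (by positivity)

theorem frontSpeed_pos {A γ τ ζ ρbar : ℝ} (hτ : 0 < τ) (hζ : 0 < ζ) (hρ : 0 < ρbar) :
    0 < frontSpeed A γ τ ζ ρbar :=
  Real.sqrt_pos.2 (by positivity)

/-! ### Finite speed of propagation -/

/-- The energy density of the system linearised at the rest state `(ρbar, 0, 0)`, with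
`a = c_s(ρbar)²`, as a function of the perturbation `(r, u, p)`. -/
noncomputable def energyDensity (a τ ζ ρbar r : ℝ) (u : Fin 3 → ℝ) (p : ℝ) : ℝ :=
  (a / ρbar * r ^ 2 + ρbar * ∑ i, u i ^ 2 + τ / ζ * p ^ 2) / 2

/-- The energy flux `(a r + p) u` of the linearised system is at most the front speed times the
energy density. -/
theorem abs_flux_le {a τ ζ ρbar c d r p : ℝ} {u y : Fin 3 → ℝ} (ha : 0 < a) (hτ : 0 < τ)
    (hζ : 0 < ζ) (hρ : 0 < ρbar) (hc : 0 < c) (hc2 : c ^ 2 = a + ζ / (ρbar * τ)) (hd : 0 ≤ d)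
    (hy : ∑ k, y k ^ 2 ≤ d ^ 2) :
    |(a * r + p) * ∑ k, y k * u k| ≤ d * c * energyDensity a τ ζ ρbar r u p := by
  have hu : 0 ≤ ∑ k, u k ^ 2 := Finset.sum_nonneg fun k _ => sq_nonneg _
  have he : 0 ≤ energyDensity a τ ζ ρbar r u p := by unfold energyDensity; positivity
  refine abs_le_of_sq_le_sq ?_ (by positivity)
  set α := a / ρbar * r ^ 2 + τ / ζ * p ^ 2 with hα
  set U := ∑ k, u k ^ 2 with hU
  have hα0 : 0 ≤ α := by positivity
  have h1 : (∑ k, y k * u k) ^ 2 ≤ d ^ 2 * U :=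
    (Finset.sum_mul_sq_le_sq_mul_sq _ _ _).trans (mul_le_mul_of_nonneg_right hy hu)
  have h2 : (a * r + p) ^ 2 ≤ α * (ρbar * c ^ 2) := by
    have : α * (ρbar * c ^ 2) - (a * r + p) ^ 2
        = a * ρbar * τ / ζ * (p - ζ / (τ * ρbar) * r) ^ 2 := by
      rw [hc2, hα]; field_simp; ring
    have h3 : 0 ≤ a * ρbar * τ / ζ * (p - ζ / (τ * ρbar) * r) ^ 2 := by positivity
    linarith
  have h3 : energyDensity a τ ζ ρbar r u p = (α + ρbar * U) / 2 := by
    rw [energyDensity, hα]; ring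
  rw [h3, mul_pow]
  calc (a * r + p) ^ 2 * (∑ k, y k * u k) ^ 2 ≤ α * (ρbar * c ^ 2) * (d ^ 2 * U) :=
        mul_le_mul h2 h1 (sq_nonneg _) (by positivity)
    _ = (d * c) ^ 2 * (α * (ρbar * U)) := by ring
    _ ≤ (d * c) ^ 2 * ((α + ρbar * U) / 2) ^ 2 :=
        mul_le_mul_of_nonneg_left (by nlinarith [sq_nonneg (α - ρbar * U)]) (sq_nonneg _)
    _ = (d * c * ((α + ρbar * U) / 2)) ^ 2 := by ring

/-- Pointwise form of the energy estimate: the time derivative of the energy density plus the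
divergence of the linearised flux `(a r + p) u` is at most a constant times the energy density. The
nonlinear system is the linearised one up to an error of the size of the perturbation `(r, u, p)`,
as long as the density and the first derivatives (`ut` in time, `rx`, `ux`, `px` in space) are
bounded by `B`. -/
theorem energy_balance_le {a τ ζ ρbar B L cs2 r rt p pt : ℝ} {u ut rx px : Fin 3 → ℝ}
    {ux : Fin 3 → Fin 3 → ℝ} (ha : 0 < a) (hτ : 0 < τ) (hζ : 0 < ζ) (hρ : 0 < ρbar) (hB : 0 ≤ B)
    (hL : 0 ≤ L) (hmass : rt + ∑ k, ((r + ρbar) * ux k k + u k * rx k) = 0)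
    (hmom : ∀ i, (r + ρbar) * ut i + (r + ρbar) * ∑ k, u k * ux k i + cs2 * rx i + px i = 0)
    (hrel : τ * pt + τ * ∑ k, (p * ux k k + u k * px k) + p + ζ * ∑ k, ux k k = 0)
    (hcs : |cs2 - a| ≤ L * |r|) (hr : |r + ρbar| ≤ B) (hut : ∀ i, |ut i| ≤ B)
    (hrx : ∀ i, |rx i| ≤ B) (hpx : ∀ i, |px i| ≤ B) (hux : ∀ k i, |ux k i| ≤ B) :
    (a / ρbar * (r * rt) + ρbar * ∑ i, u i * ut i + τ / ζ * (p * pt))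
      + ∑ k, ((a * r + p) * ux k k + u k * (a * rx k + px k))
      ≤ (a / ρbar * (6 * B) + 3 * (B + B * (3 * B) + L * B) + 1 / ζ * (τ * (6 * B) + 1))
        * (10 * (ρbar / a + 1 / ρbar + ζ / τ)) * energyDensity a τ ζ ρbar r u p := by
  set N := |r| + ∑ i, |u i| + |p| with hN
  have hr0 := abs_nonneg r
  have hp0 := abs_nonneg p
  have hus : ∀ i, |u i| ≤ ∑ i, |u i| := fun i =>
    Finset.single_le_sum (f := fun i => |u i|) (fun i _ => abs_nonneg _) (Finset.mem_univ i)
  have hu0 : 0 ≤ ∑ i, |u i| := Finset.sum_nonneg fun i _ => abs_nonneg _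
  have hN0 : 0 ≤ N := by positivity
  have hrN : |r| ≤ N := by linarith
  have hpN : |p| ≤ N := by linarith
  have huN : ∀ i, |u i| ≤ N := fun i => by linarith [hus i]
  have hNe : N ^ 2 ≤ 10 * (ρbar / a + 1 / ρbar + ζ / τ) * energyDensity a τ ζ ρbar r u p := by
    have h1 : N ^ 2 ≤ 5 * (r ^ 2 + ∑ i, u i ^ 2 + p ^ 2) := by
      have h5 := sq_sum_le_card_mul_sum_sq (s := Finset.univ)
        (f := ![|r|, |u 0|, |u 1|, |u 2|, |p|])
      simp [Fin.sum_univ_succ, sq_abs] at h5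
      simp only [hN, Fin.sum_univ_three]
      simpa [add_assoc] using h5
    have hU : 0 ≤ ∑ i, u i ^ 2 := Finset.sum_nonneg fun k _ => sq_nonneg _
    set U := ∑ i, u i ^ 2
    have h2 : 10 * (ρbar / a + 1 / ρbar + ζ / τ) * energyDensity a τ ζ ρbar r u p
        - 5 * (r ^ 2 + U + p ^ 2)
        = 5 * ((1 / ρbar + ζ / τ) * (a / ρbar * r ^ 2) + (ρbar / a + ζ / τ) * (ρbar * U)
          + (ρbar / a + 1 / ρbar) * (τ / ζ * p ^ 2)) := by
      rw [energyDensity]; field_simp; ring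
    have h3 : 0 ≤ 5 * ((1 / ρbar + ζ / τ) * (a / ρbar * r ^ 2) + (ρbar / a + ζ / τ) * (ρbar * U)
          + (ρbar / a + 1 / ρbar) * (τ / ζ * p ^ 2)) := by positivity
    linarith
  have hmul : ∀ {x y X Y : ℝ}, |x| ≤ X → |y| ≤ Y → |x * y| ≤ X * Y := fun hx hy => by
    rw [abs_mul]
    exact mul_le_mul hx hy (abs_nonneg _) ((abs_nonneg _).trans hx)
  have hsum : ∀ {f : Fin 3 → ℝ} {X : ℝ}, (∀ k, |f k| ≤ X) → |∑ k, f k| ≤ 3 * X := by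
    intro f X h
    calc |∑ k, f k| ≤ ∑ k, |f k| := Finset.abs_sum_le_sum_abs _ _
      _ ≤ ∑ _k : Fin 3, X := Finset.sum_le_sum fun k _ => h k
      _ = 3 * X := by simp
  set R₁ := -∑ k, (r * ux k k + u k * rx k) with hR₁
  set R₂ : Fin 3 → ℝ := fun i =>
    -(r * ut i + (r + ρbar) * ∑ k, u k * ux k i + (cs2 - a) * rx i) with hR₂
  set R₃ := -(τ * ∑ k, (p * ux k k + u k * px k) + p) with hR₃
  have hkey : (a / ρbar * (r * rt) + ρbar * ∑ i, u i * ut i + τ / ζ * (p * pt))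
      + ∑ k, ((a * r + p) * ux k k + u k * (a * rx k + px k))
      = a / ρbar * (r * R₁) + ∑ i, u i * R₂ i + 1 / ζ * (p * R₃) := by
    have e1 : rt = R₁ - ρbar * ∑ k, ux k k := by
      simp only [hR₁, Fin.sum_univ_three] at hmass ⊢; linarith
    have e2 : ∀ i, ρbar * ut i = R₂ i - a * rx i - px i := fun i => by
      simp only [hR₂]; linarith [hmom i]
    have e3 : τ * pt = R₃ - ζ * ∑ k, ux k k := by simp only [hR₃]; linarith
    have e4 : ρbar * ∑ i, u i * ut i = ∑ i, u i * (R₂ i - a * rx i - px i) := by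
      simp_rw [← e2, Finset.mul_sum]
      exact Finset.sum_congr rfl fun i _ => by ring
    have e5 : τ / ζ * (p * pt) = 1 / ζ * (p * (τ * pt)) := by ring
    rw [e4, e5, e3, e1]
    clear_value R₁ R₂ R₃
    simp only [Fin.sum_univ_three]
    field_simp
    ring
  have b1 : |R₁| ≤ 6 * B * N := by
    rw [hR₁, abs_neg]
    refine (hsum (X := N * B + N * B) fun k => (abs_add_le _ _).trans
      (add_le_add (hmul hrN (hux k k)) (hmul (huN k) (hrx k)))).trans (by linarith)
  have b2 : ∀ i, |R₂ i| ≤ (B + B * (3 * B) + L * B) * N := by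
    intro i
    have h1 : |r * ut i| ≤ N * B := hmul hrN (hut i)
    have h2 : |(r + ρbar) * ∑ k, u k * ux k i| ≤ B * (3 * (N * B)) :=
      hmul hr (hsum fun k => hmul (huN k) (hux k i))
    have h3 : |(cs2 - a) * rx i| ≤ L * N * B :=
      hmul (hcs.trans (mul_le_mul_of_nonneg_left hrN hL)) (hrx i)
    have h4 := abs_add_three (r * ut i) ((r + ρbar) * ∑ k, u k * ux k i) ((cs2 - a) * rx i)
    simp only [hR₂, abs_neg]
    linarith
  have b3 : |R₃| ≤ (τ * (6 * B) + 1) * N := by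
    have h1 : |τ * ∑ k, (p * ux k k + u k * px k)| ≤ τ * (3 * (N * B + N * B)) :=
      hmul (abs_of_pos hτ).le (hsum fun k => (abs_add_le _ _).trans
      (add_le_add (hmul hpN (hux k k)) (hmul (huN k) (hpx k))))
    have h2 := abs_add_le (τ * ∑ k, (p * ux k k + u k * px k)) p
    rw [hR₃, abs_neg]
    linarith
  have c1 : r * R₁ ≤ N * (6 * B * N) := (le_abs_self _).trans (hmul hrN b1)
  have c2 : ∑ i, u i * R₂ i ≤ 3 * (N * ((B + B * (3 * B) + L * B) * N)) :=
    (le_abs_self _).trans (hsum fun i => hmul (huN i) (b2 i))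
  have c3 : p * R₃ ≤ N * ((τ * (6 * B) + 1) * N) := (le_abs_self _).trans (hmul hpN b3)
  have c1' := mul_le_mul_of_nonneg_left c1 (by positivity : 0 ≤ a / ρbar)
  have c3' := mul_le_mul_of_nonneg_left c3 (by positivity : 0 ≤ 1 / ζ)
  rw [hkey]
  calc a / ρbar * (r * R₁) + ∑ i, u i * R₂ i + 1 / ζ * (p * R₃)
      ≤ (a / ρbar * (6 * B) + 3 * (B + B * (3 * B) + L * B) + 1 / ζ * (τ * (6 * B) + 1))
        * N ^ 2 := by linarith
    _ ≤ (a / ρbar * (6 * B) + 3 * (B + B * (3 * B) + L * B) + 1 / ζ * (τ * (6 * B) + 1))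
        * (10 * (ρbar / a + 1 / ρbar + ζ / τ) * energyDensity a τ ζ ρbar r u p) :=
        mul_le_mul_of_nonneg_left hNe (by positivity)
    _ = _ := by ring

section Propagation

variable {A γ τ ζ T ρbar : ℝ} {ρ : ℝ → E3 → ℝ} {v : ℝ → E3 → E3} {bulk : ℝ → E3 → ℝ}

theorem energyDensity_nonneg {a r p : ℝ} {u : Fin 3 → ℝ} (ha : 0 < a) (hτ : 0 < τ) (hζ : 0 < ζ)
    (hρ : 0 < ρbar) : 0 ≤ energyDensity a τ ζ ρbar r u p := by
  have hu : 0 ≤ ∑ k, u k ^ 2 := Finset.sum_nonneg fun k _ => sq_nonneg _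
  unfold energyDensity
  positivity

theorem eq_zero_of_energyDensity_eq_zero {a r p : ℝ} {u : Fin 3 → ℝ} (ha : 0 < a) (hτ : 0 < τ)
    (hζ : 0 < ζ) (hρ : 0 < ρbar) (h : energyDensity a τ ζ ρbar r u p = 0) :
    r = 0 ∧ (∀ i, u i = 0) ∧ p = 0 := by
  have hu : 0 ≤ ∑ k, u k ^ 2 := Finset.sum_nonneg fun k _ => sq_nonneg _
  have h1 : 0 ≤ a / ρbar * r ^ 2 := by positivity
  have h2 : 0 ≤ ρbar * ∑ k, u k ^ 2 := by positivity
  have h3 : 0 ≤ τ / ζ * p ^ 2 := by positivity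
  unfold energyDensity at h
  have e1 : a / ρbar * r ^ 2 = 0 := by linarith
  have e2 : ρbar * ∑ k, u k ^ 2 = 0 := by linarith
  have e3 : τ / ζ * p ^ 2 = 0 := by linarith
  have e2' : ∑ k, u k ^ 2 = 0 := by simpa [hρ.ne'] using e2
  refine ⟨by simpa [ha.ne', hρ.ne'] using e1, fun i => ?_, by simpa [hτ.ne', hζ.ne'] using e3⟩
  simpa using (Finset.sum_eq_zero_iff_of_nonneg fun k _ => sq_nonneg (u k)).1 e2' i
    (Finset.mem_univ i)

/-- The function `(c (t₀ - t))² - |x - x₀|²`, positive exactly inside the light cone of speed `c`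
with vertex `(t₀, x₀)`. -/
def coneFunction (c t₀ : ℝ) (x₀ : E3) (t : ℝ) (x : E3) : ℝ :=
  (c * (t₀ - t)) ^ 2 - ∑ k, (x k - x₀ k) ^ 2

theorem coneFunction_eq (c t₀ : ℝ) (x₀ : E3) (t : ℝ) (x : E3) :
    coneFunction c t₀ x₀ t x = (c * (t₀ - t)) ^ 2 - ‖x - x₀‖ ^ 2 := by
  rw [coneFunction, EuclideanSpace.real_norm_sq_eq]
  simp

theorem contDiff_coneFunction (c t₀ : ℝ) (x₀ : E3) :
    ContDiff ℝ 1 fun p : ℝ × E3 => coneFunction c t₀ x₀ p.1 p.2 := by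
  unfold coneFunction
  fun_prop

theorem partialX_coneFunction (c t₀ : ℝ) (x₀ : E3) (t : ℝ) (x : E3) (i : Fin 3) :
    partialX i (coneFunction c t₀ x₀ t) x = -(2 * (x i - x₀ i)) := by
  have h : ∀ k : Fin 3, partialX i (fun y : E3 => (-1 : ℝ) * (y k - x₀ k) ^ 2) x =
      if k = i then -(2 * (x i - x₀ i)) else 0 := by
    intro k
    have hφ : HasDerivAt (fun s : ℝ => (-1 : ℝ) * (s - x₀ k) ^ 2)
        (-1 * (2 * (x k - x₀ k))) (x k) := by
      simpa using (((hasDerivAt_id (x k)).sub_const (x₀ k)).pow 2).const_mul (-1 : ℝ)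
    rw [partialX_comp (f := fun y : E3 => y k) hφ (by fun_prop), partialX_coord]
    split_ifs with hk
    · subst hk; ring
    · ring
  have h1 : coneFunction c t₀ x₀ t =
      fun y => (∑ k, (-1 : ℝ) * (y k - x₀ k) ^ 2) - -(c * (t₀ - t)) ^ 2 := by
    funext y
    rw [coneFunction, ← Finset.mul_sum]
    ring
  rw [h1, partialX_sub_const, partialX_sum fun j => by fun_prop,
    Finset.sum_congr rfl fun k _ => h k]
  simp

theorem hasDerivAt_coneFunction (c t₀ : ℝ) (x₀ : E3) (t : ℝ) (x : E3) :
    HasDerivAt (fun s => coneFunction c t₀ x₀ s x) (-(2 * (c * (c * (t₀ - t))))) t := by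
  have h : HasDerivAt (fun s => coneFunction c t₀ x₀ s x) _ t :=
    (((((hasDerivAt_id t).const_sub t₀).const_mul c).pow 2).sub_const
      (∑ k, (x k - x₀ k) ^ 2))
  convert h using 1
  simp
  ring

/-- A solution that is initially at rest on the base of a light cone is at rest on the axis of
the cone. The proof is an energy estimate weighted by the square of the positive part of
`coneFunction`, which decreases in time fast enough to absorb the energy flux. -/
theorem IsC1Solution.eq_rest_of_cone (h : IsC1Solution A γ τ ζ T ρ v bulk) (hA : 0 < A)
    (hγ : 1 < γ) (hτ : 0 < τ) (hζ : 0 < ζ) (hρbar : 0 < ρbar) (hT : 0 < T) {t₀ : ℝ}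
    (ht₀ : T < t₀) {x₀ : E3}
    (hinit : ∀ x ∈ Metric.closedBall x₀ (frontSpeed A γ τ ζ ρbar * t₀),
      ρ 0 x = ρbar ∧ v 0 x = 0 ∧ bulk 0 x = 0) :
    ρ T x₀ = ρbar ∧ v T x₀ = 0 ∧ bulk T x₀ = 0 := by
  set c := frontSpeed A γ τ ζ ρbar with hc_def
  have hc : 0 < c := frontSpeed_pos hτ hζ hρbar
  set a := soundSpeed A γ ρbar ^ 2 with ha_def
  have ha : 0 < a := by
    rw [ha_def, soundSpeed_sq_of_nonneg hA hγ hρbar.le]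
    have := Real.rpow_pos_of_pos hρbar (γ - 1)
    positivity
  have hc2 : c ^ 2 = a + ζ / (ρbar * τ) := frontSpeed_sq hτ hζ hρbar
  set K := Metric.closedBall x₀ (c * t₀) with hK_def
  have hK : IsCompact K := isCompact_closedBall _ _
  set ψ := coneFunction c t₀ x₀ with hψ_def
  set e : ℝ → E3 → ℝ := fun t x =>
    energyDensity a τ ζ ρbar (ρ t x - ρbar) (fun i => v t x i) (bulk t x) with he_def
  have he0 : ∀ t x, 0 ≤ e t x := fun t x => energyDensity_nonneg ha hτ hζ hρbar
  have heslab : IsC1Slab T e := by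
    have h1 := (((((h.density.sub_const ρbar).pow 2).const_mul (a / ρbar)).add
      ((IsC1Slab.sum fun i => (h.velocity i).pow 2).const_mul ρbar)).add
      ((h.bulkStress.pow 2).const_mul (τ / ζ))).const_mul (1 / 2)
    convert h1 using 3
    rw [he_def]
    simp only [energyDensity]
    ring
  have hψslab : IsC1Slab T ψ := isC1Slab_of_contDiff (contDiff_coneFunction c t₀ x₀) T
  set η : ℝ → E3 → ℝ := fun t x => max (ψ t x) 0 ^ 2 * e t x with hη_def
  have hη0 : ∀ t x, 0 ≤ η t x := fun t x => mul_nonneg (sq_nonneg _) (he0 t x)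
  have hηslab : IsC1Slab T η := (IsC1Slab.comp contDiff_max_zero_sq hψslab).mul heslab
  have hψpos : ∀ t ∈ Icc 0 T, ∀ x, 0 < ψ t x → x ∈ K ∧ ‖x - x₀‖ ≤ c * (t₀ - t) := by
    intro t ht x hx
    rw [hψ_def, coneFunction_eq] at hx
    have h2 : 0 ≤ c * (t₀ - t) := mul_nonneg hc.le (by linarith [ht.2])
    have h1 : ‖x - x₀‖ ≤ c * (t₀ - t) :=
      abs_le_of_sq_le_sq' (by linarith) h2 |>.2
    refine ⟨?_, h1⟩
    rw [hK_def, mem_closedBall_iff_norm]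
    nlinarith [ht.1]
  have hψout : ∀ t ∈ Icc 0 T, ∀ x ∉ K, max (ψ t x) 0 = 0 := by
    intro t ht x hx
    refine max_eq_right ?_
    by_contra! hcon
    exact hx (hψpos t ht x hcon).1
  have hηK : ∀ t ∈ Icc 0 T, ∀ x ∉ K, η t x = 0 := fun t ht x hx => by
    simp only [hη_def, hψout t ht x hx]
    ring
  obtain ⟨B₁, hB₁, b₁⟩ := h.density.exists_bound hT hK
  obtain ⟨B₂, hB₂, b₂⟩ := h.bulkStress.exists_bound hT hK
  choose B₃ hB₃ b₃ using fun i => (h.velocity i).exists_bound hT hK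
  have hB₃s : ∀ i, B₃ i ≤ ∑ i, B₃ i := fun i =>
    Finset.single_le_sum (fun i _ => hB₃ i) (Finset.mem_univ i)
  set B := B₁ + B₂ + ∑ i, B₃ i with hB_def
  have hsum0 : 0 ≤ ∑ i, B₃ i := Finset.sum_nonneg fun i _ => hB₃ i
  have hB1 : B₁ ≤ B := by linarith
  have hB2 : B₂ ≤ B := by linarith
  have hB3 : ∀ i, B₃ i ≤ B := fun i => by linarith [hB₃s i]
  obtain ⟨L, hL, hcs⟩ := exists_soundSpeed_sq_sub_le hA hγ hρbar B
  set C := (a / ρbar * (6 * B) + 3 * (B + B * (3 * B) + L * B) + 1 / ζ * (τ * (6 * B) + 1))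
        * (10 * (ρbar / a + 1 / ρbar + ζ / τ)) with hC_def
  set q : ℝ → Fin 3 → E3 → ℝ := fun t k x =>
    max (ψ t x) 0 ^ 2 * ((a * (ρ t x - ρbar) + bulk t x) * v t x k) with hq_def
  have hqslab : ∀ k, IsC1Slab T fun t x => q t k x := fun k =>
    (IsC1Slab.comp contDiff_max_zero_sq hψslab).mul
      ((((h.density.sub_const ρbar).const_mul a).add h.bulkStress).mul (h.velocity k))
  have hbal : ∀ t ∈ Ioo 0 T, Integrable (fun x => partialT T η t x + ∑ k, partialX k (q t k) x) ∧
      HasDerivAt (fun t => ∫ x, η t x) (∫ x, (partialT T η t x + ∑ k, partialX k (q t k) x)) t := by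
    intro t ht
    have ht' := Ioo_subset_Icc_self ht
    refine integrable_and_hasDerivAt_integral_of_balance hK ht hηslab hηK
      (fun k => (hqslab k).contDiff ht') (fun k x hx => ?_) fun x => rfl
    simp only [hq_def, hψout t ht' x hx]
    ring
  have hpt : ∀ t ∈ Ioo 0 T, ∀ x, partialT T η t x + ∑ k, partialX k (q t k) x ≤ C * η t x := by
    intro t ht x
    have ht' := Ioo_subset_Icc_self ht
    have dρ := h.density.hasDerivAt_partialT ht x
    have dv := fun i => (h.velocity i).hasDerivAt_partialT ht x
    have db := h.bulkStress.hasDerivAt_partialT ht x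
    have de : HasDerivAt (fun s => e s x)
        (a / ρbar * ((ρ t x - ρbar) * partialT T ρ t x)
          + ρbar * ∑ i, v t x i * partialT T (fun s y => v s y i) t x
          + τ / ζ * (bulk t x * partialT T bulk t x)) t := by
      have h1 : HasDerivAt (fun s => e s x) _ t :=
        ((((((dρ.sub_const ρbar).pow 2).const_mul (a / ρbar)).add
        ((HasDerivAt.fun_sum (u := Finset.univ) fun i _ => (dv i).pow 2).const_mul ρbar)).add
        ((db.pow 2).const_mul (τ / ζ))).div_const 2)
      convert h1 using 1
      simp only [Fin.sum_univ_three]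
      ring
    have dφ : HasDerivAt (fun s => max (ψ s x) 0 ^ 2)
        (2 * max (ψ t x) 0 * -(2 * (c * (c * (t₀ - t))))) t :=
      HasDerivAt.comp (h := fun s => ψ s x) t (hasDerivAt_max_zero_sq (ψ t x))
        (hasDerivAt_coneFunction c t₀ x₀ t x)
    have dη' : HasDerivAt (fun s => η s x) _ t := dφ.mul de
    have dη := partialT_eq_of_hasDerivAt ht dη'
    have fψ := hψslab.differentiable ht' x
    have fρ := h.density.differentiable ht' x
    have fb := h.bulkStress.differentiable ht' x
    have fv := fun k => (h.velocity k).differentiable ht' x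
    have dq : ∀ k, partialX k (q t k) x = max (ψ t x) 0 ^ 2 *
        ((a * (ρ t x - ρbar) + bulk t x) * partialX k (fun y => v t y k) x
          + v t x k * (a * partialX k (ρ t) x + partialX k (bulk t) x))
        + (a * (ρ t x - ρbar) + bulk t x) * v t x k
          * (2 * max (ψ t x) 0 * -(2 * (x k - x₀ k))) := by
      intro k
      have e1 : partialX k (fun y => max (ψ t y) 0 ^ 2) x
          = 2 * max (ψ t x) 0 * -(2 * (x k - x₀ k)) := by
        rw [partialX_comp (f := ψ t) (hasDerivAt_max_zero_sq (ψ t x)) fψ, hψ_def,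
          partialX_coneFunction]
      have e2 : partialX k (fun y => a * (ρ t y - ρbar) + bulk t y) x
          = a * partialX k (ρ t) x + partialX k (bulk t) x := by
        rw [partialX_add (by fun_prop) fb, partialX_mul (by fun_prop) (by fun_prop),
          partialX_const, partialX_sub_const]
        ring
      have hfm : DifferentiableAt ℝ (fun y => max (ψ t y) 0 ^ 2) x :=
        (hasDerivAt_max_zero_sq (ψ t x)).differentiableAt.comp x fψ
      rw [hq_def]
      simp only
      rw [partialX_mul hfm ((by fun_prop : DifferentiableAt ℝ
        (fun y => a * (ρ t y - ρbar) + bulk t y) x).fun_mul (fv k)), e1,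
        partialX_mul (by fun_prop) (fv k), e2]
    rw [dη]
    simp only [dq]
    rcases le_or_gt (ψ t x) 0 with hneg | hpos
    · simp [hη_def, max_eq_right hneg]
    obtain ⟨hxK, hxd⟩ := hψpos t ht' x hpos
    have hd0 : 0 ≤ c * (t₀ - t) := (norm_nonneg _).trans hxd
    have hbalance := energy_balance_le (a := a) (τ := τ) (ζ := ζ) (ρbar := ρbar) (B := B) (L := L)
      (cs2 := soundSpeed A γ (ρ t x) ^ 2) (r := ρ t x - ρbar) (rt := partialT T ρ t x)
      (p := bulk t x) (pt := partialT T bulk t x) (u := fun i => v t x i)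
      (ut := fun i => partialT T (fun s y => v s y i) t x) (rx := fun k => partialX k (ρ t) x)
      (px := fun k => partialX k (bulk t) x) (ux := fun k i => partialX k (fun y => v t y i) x)
      ha hτ hζ hρbar (by positivity) hL
      (by simpa using h.mass_expanded ht' x) (by simpa using h.momentum t ht' x)
      (h.relaxation_expanded ht' x) (hcs _ ((b₁ t ht' x hxK).1.trans hB1))
      (by simpa using (b₁ t ht' x hxK).1.trans hB1)
      (fun i => (b₃ i t ht' x hxK).2.1.trans (hB3 i))
      (fun i => ((b₁ t ht' x hxK).2.2 i).trans hB1)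
      (fun i => ((b₂ t ht' x hxK).2.2 i).trans hB2)
      (fun k i => ((b₃ i t ht' x hxK).2.2 k).trans (hB3 i))
    have hflux := abs_flux_le (a := a) (τ := τ) (ζ := ζ) (ρbar := ρbar) (c := c)
      (d := c * (t₀ - t)) (r := ρ t x - ρbar) (p := bulk t x) (u := fun i => v t x i)
      (y := fun k => x k - x₀ k) ha hτ hζ hρbar hc hc2 hd0 (by
        have := EuclideanSpace.real_norm_sq_eq (x - x₀)
        simp only [PiLp.sub_apply] at this
        rw [← this]
        gcongr)
    have hbalance' : _ ≤ C * e t x := hbalance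
    have hflux' : |(a * (ρ t x - ρbar) + bulk t x) * ∑ k, (x k - x₀ k) * v t x k|
        ≤ c * (t₀ - t) * c * e t x := hflux
    have hflux2 := (abs_le.1 hflux').1
    simp only [hη_def, max_eq_left hpos.le]
    set S := ∑ k, ((a * (ρ t x - ρbar) + bulk t x) * partialX k (fun y => v t y k) x
          + v t x k * (a * partialX k (ρ t) x + partialX k (bulk t) x)) with hS
    set Y := ∑ k, (x k - x₀ k) * v t x k with hY
    have hsum : ∑ k, (ψ t x ^ 2 *
        ((a * (ρ t x - ρbar) + bulk t x) * partialX k (fun y => v t y k) x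
          + v t x k * (a * partialX k (ρ t) x + partialX k (bulk t) x))
        + (a * (ρ t x - ρbar) + bulk t x) * v t x k * (2 * ψ t x * -(2 * (x k - x₀ k))))
        = ψ t x ^ 2 * S - 4 * ψ t x * ((a * (ρ t x - ρbar) + bulk t x) * Y) := by
      rw [hS, hY]
      simp only [Fin.sum_univ_three]
      ring
    rw [hsum]
    -- The decay of the weight, `-4 ψ c² (t₀ - t) e`, absorbs the term `-4 ψ (a r + p) Y`.
    have m1 := mul_le_mul_of_nonneg_left hbalance' (sq_nonneg (ψ t x))
    have m2 := mul_le_mul_of_nonneg_left hflux2 (by positivity : 0 ≤ 4 * ψ t x)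
    linarith
  have hE : ∫ x, η T x ≤ 0 := by
    refine nonpos_of_deriv_le_mul (E := fun t => ∫ x, η t x) (C := C)
      (hηslab.continuousOn_integral hK hηK) (fun t ht => (hbal t ht).2) (fun t ht => ?_) ?_
      ⟨hT.le, le_rfl⟩
    · have ht' := Ioo_subset_Icc_self ht
      rw [← integral_const_mul]
      exact integral_mono (hbal t ht).1
        ((integrable_of_eqOn_compl hK (hηslab.contDiff ht').continuous (hηK t ht')).const_mul C)
        (hpt t ht)
    · have hη00 : ∀ x, η 0 x = 0 := by
        intro x
        by_cases hx : x ∈ K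
        · obtain ⟨h1, h2, h3⟩ := hinit x hx
          simp [hη_def, he_def, energyDensity, h1, h2, h3]
        · exact hηK 0 ⟨le_rfl, hT.le⟩ x hx
      simp [hη00]
  have hTmem : T ∈ Icc 0 T := ⟨hT.le, le_rfl⟩
  have hηT : η T = 0 := by
    have hcont := (hηslab.contDiff hTmem).continuous
    have h0 := (integral_eq_zero_iff_of_nonneg (hη0 T)
      (integrable_of_eqOn_compl hK hcont (hηK T hTmem))).1
      (le_antisymm hE (integral_nonneg (hη0 T)))
    exact (hcont.ae_eq_iff_eq volume continuous_zero).1 h0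
  have hψT : 0 < ψ T x₀ := by
    rw [hψ_def, coneFunction_eq]
    have : 0 < c * (t₀ - T) := mul_pos hc (by linarith)
    simpa using (by positivity : 0 < (c * (t₀ - T)) ^ 2)
  have heT : e T x₀ = 0 := by
    have := congrFun hηT x₀
    simp only [hη_def, max_eq_left hψT.le, Pi.zero_apply, mul_eq_zero] at this
    rcases this with h1 | h1
    · exact absurd h1 (by positivity)
    · exact h1
  obtain ⟨h1, h2, h3⟩ := eq_zero_of_energyDensity_eq_zero ha hτ hζ hρbar heT
  exact ⟨sub_eq_zero.1 h1, by ext i; exact h2 i, h3⟩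

/-- Finite speed of propagation: a perturbation of the rest state supported in the ball of radius
`R` is supported in the ball of radius `R + c t` at time `t`, with `c` the front speed. -/
theorem IsC1Solution.eq_rest_outside (h : IsC1Solution A γ τ ζ T ρ v bulk) (hA : 0 < A)
    (hγ : 1 < γ) (hτ : 0 < τ) (hζ : 0 < ζ) (hρbar : 0 < ρbar) {R : ℝ}
    (hinit : ∀ x, R ≤ ‖x‖ → ρ 0 x = ρbar ∧ v 0 x = 0 ∧ bulk 0 x = 0) {t : ℝ} (ht : t ∈ Icc 0 T)
    {x : E3} (hx : x ∉ Metric.closedBall 0 (R + frontSpeed A γ τ ζ ρbar * t)) :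
    ρ t x = ρbar ∧ v t x = 0 ∧ bulk t x = 0 := by
  have hc := frontSpeed_pos (A := A) (γ := γ) hτ hζ hρbar
  set c := frontSpeed A γ τ ζ ρbar
  rw [mem_closedBall_zero_iff, not_le] at hx
  rcases ht.1.eq_or_lt with rfl | ht0
  · exact hinit x (by linarith)
  -- The vertex is put slightly above `(t, x)`, so that the base of the cone still lies outside
  -- the ball of radius `R`.
  refine (h.mono ht0 ht.2).eq_rest_of_cone hA hγ hτ hζ hρbar ht0
    (t₀ := t + (‖x‖ - (R + c * t)) / c) (by
      have : 0 < (‖x‖ - (R + c * t)) / c := div_pos (by linarith) hc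
      linarith) fun y hy => hinit y ?_
  rw [mem_closedBall_iff_norm] at hy
  have h1 : c * (t + (‖x‖ - (R + c * t)) / c) = ‖x‖ - R := by
    field_simp; ring
  have h2 := norm_sub_norm_le x y
  rw [norm_sub_rev] at h2
  linarith

end Propagation

/-! ### Nonnegativity of the density and the evolution of the integral functionals -/

theorem contDiff_pressure (A : ℝ) {γ : ℝ} (hγ : 1 < γ) : ContDiff ℝ 1 (pressure A γ) := by
  have h : ContDiff ℝ 1 fun r : ℝ => r ^ γ := by
    exact_mod_cast Real.contDiff_rpow_const_of_le (n := 1) (by exact_mod_cast hγ.le)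
  exact contDiff_const.mul h

/-- The pressure lies above its tangent line at `ρbar`. -/
theorem tangent_le_pressure {A γ ρbar r : ℝ} (hA : 0 < A) (hγ : 1 < γ) (hρ : 0 < ρbar)
    (hr : 0 ≤ r) :
    A * ρbar ^ γ * γ / ρbar * (r - ρbar) ≤ pressure A γ r - pressure A γ ρbar := by
  have h := one_add_mul_self_le_rpow_one_add (s := r / ρbar - 1)
    (by linarith [div_nonneg hr hρ.le]) hγ.le
  rw [add_sub_cancel, Real.div_rpow hr hρ.le] at h
  have hpos := Real.rpow_pos_of_pos hρ γ
  rw [le_div_iff₀ hpos] at h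
  have h2 := mul_le_mul_of_nonneg_left h hA.le
  have h3 : A * ((1 + γ * (r / ρbar - 1)) * ρbar ^ γ) =
      A * ρbar ^ γ * γ / ρbar * (r - ρbar) + A * ρbar ^ γ := by
    field_simp; ring
  simp only [pressure]
  linarith

section Functionals

variable {A γ τ ζ T ρbar : ℝ} {ρ : ℝ → E3 → ℝ} {v : ℝ → E3 → E3} {bulk : ℝ → E3 → ℝ}
  {K : Set E3}

/-- The negative part of the density stays zero, by an `L²` estimate. -/
theorem IsC1Solution.density_nonneg (h : IsC1Solution A γ τ ζ T ρ v bulk) (hT : 0 < T)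
    (hρbar : 0 < ρbar) (hK : IsCompact K)
    (hout : ∀ t ∈ Icc 0 T, ∀ x ∉ K, ρ t x = ρbar) (h0 : ∀ x, 0 ≤ ρ 0 x) {t : ℝ}
    (ht : t ∈ Icc 0 T) (x : E3) : 0 ≤ ρ t x := by
  set η : ℝ → E3 → ℝ := fun t x => max (-1 * ρ t x) 0 ^ 2 with hη_def
  have hη0 : ∀ t x, 0 ≤ η t x := fun t x => sq_nonneg _
  have hηslab : IsC1Slab T η := IsC1Slab.comp contDiff_max_zero_sq (h.density.const_mul (-1))
  have hηK : ∀ t ∈ Icc 0 T, ∀ x ∉ K, η t x = 0 := fun t ht x hx => by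
    simp [hη_def, hout t ht x hx, hρbar.le]
  choose B hB b using fun i => (h.velocity i).exists_bound hT hK
  have hBs : ∀ i, B i ≤ ∑ i, B i := fun i =>
    Finset.single_le_sum (fun i _ => hB i) (Finset.mem_univ i)
  set C := 3 * ∑ i, B i with hC
  have hbal : ∀ t ∈ Ioo 0 T, Integrable (fun x => -η t x * divX (v t) x) ∧
      HasDerivAt (fun t => ∫ x, η t x) (∫ x, -η t x * divX (v t) x) t := by
    intro t ht
    have ht' := Ioo_subset_Icc_self ht
    refine integrable_and_hasDerivAt_integral_of_balance (q := fun k x => η t x * v t x k) hK ht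
      hηslab hηK (fun k => (hηslab.mul (h.velocity k)).contDiff ht')
      (fun k x hx => by simp [hηK t ht' x hx]) fun x => ?_
    have dη : HasDerivAt (fun s => η s x)
        (2 * max (-1 * ρ t x) 0 * (-1 * partialT T ρ t x)) t :=
      HasDerivAt.comp (h := fun s => -1 * ρ s x) t (hasDerivAt_max_zero_sq (-1 * ρ t x))
        ((h.density.hasDerivAt_partialT ht x).const_mul (-1))
    have dx : ∀ k, partialX k (η t) x
        = 2 * max (-1 * ρ t x) 0 * (-1 * partialX k (ρ t) x) := by
      intro k
      have fρ := h.density.differentiable ht' x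
      have e : partialX k (fun y => (-1 : ℝ) * ρ t y) x = -1 * partialX k (ρ t) x := by
        rw [partialX_mul (by fun_prop) fρ, partialX_const]; ring
      rw [hη_def]
      simp only
      rw [partialX_comp (f := fun y => -1 * ρ t y) (hasDerivAt_max_zero_sq (-1 * ρ t x))
        (by fun_prop), e]
    have hm : max (-1 * ρ t x) 0 * ρ t x = -max (-1 * ρ t x) 0 ^ 2 := by
      rcases le_total (-1 * ρ t x) 0 with hs | hs
      · rw [max_eq_right hs]; ring
      · rw [max_eq_left hs]; ring
    have hmass := h.mass_expanded ht' x
    rw [partialT_eq_of_hasDerivAt ht dη]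
    simp only [partialX_mul (hηslab.differentiable ht' x) ((h.velocity _).differentiable ht' x),
      dx, divX, Fin.sum_univ_three] at hmass ⊢
    simp only [hη_def]
    linear_combination (-2 * max (-1 * ρ t x) 0) * hmass
      + 2 * (partialX 0 (fun y => v t y 0) x + partialX 1 (fun y => v t y 1) x
        + partialX 2 (fun y => v t y 2) x) * hm
  have hle : ∫ x, η t x ≤ 0 := by
    refine nonpos_of_deriv_le_mul (E := fun t => ∫ x, η t x) (C := C)
      (hηslab.continuousOn_integral hK hηK) (fun t ht => (hbal t ht).2) (fun t ht => ?_) ?_ ht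
    · have ht' := Ioo_subset_Icc_self ht
      rw [← integral_const_mul]
      refine integral_mono (hbal t ht).1
        ((integrable_of_eqOn_compl hK (hηslab.contDiff ht').continuous (hηK t ht')).const_mul C)
        fun x => ?_
      by_cases hx : x ∈ K
      · have h1 : |divX (v t) x| ≤ C :=
          calc |divX (v t) x| ≤ ∑ i, |partialX i (fun y => v t y i) x| :=
                Finset.abs_sum_le_sum_abs _ _
            _ ≤ ∑ _i : Fin 3, ∑ i, B i :=
                Finset.sum_le_sum fun i _ => ((b i t ht' x hx).2.2 i).trans (hBs i)
            _ = C := by simp [hC]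
        simp only
        nlinarith [(abs_le.1 h1).1, hη0 t x]
      · simp [hηK t ht' x hx]
    · simp [hη_def, max_eq_right (neg_nonpos.2 (h0 _))]
  have hηt : η t = 0 := by
    have hcont := (hηslab.contDiff ht).continuous
    exact (hcont.ae_eq_iff_eq volume continuous_zero).1
      ((integral_eq_zero_iff_of_nonneg (hη0 t)
        (integrable_of_eqOn_compl hK hcont (hηK t ht))).1
        (le_antisymm hle (integral_nonneg (hη0 t))))
  have h2 := congrFun hηt x
  simp only [hη_def, Pi.zero_apply, ne_eq, OfNat.ofNat_ne_zero, not_false_eq_true,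
    pow_eq_zero_iff] at h2
  linarith [max_eq_right_iff.1 h2]

theorem IsC1Solution.relativeMass_eq (h : IsC1Solution A γ τ ζ T ρ v bulk) (hK : IsCompact K)
    (hρK : ∀ t ∈ Icc 0 T, ∀ x ∉ K, ρ t x = ρbar) (hvK : ∀ t ∈ Icc 0 T, ∀ x ∉ K, v t x = 0)
    {t : ℝ} (ht : t ∈ Icc 0 T) : relativeMass ρbar ρ t = relativeMass ρbar ρ 0 := by
  have hηK : ∀ t ∈ Icc 0 T, ∀ x ∉ K, ρ t x - ρbar = 0 := fun t ht x hx => by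
    rw [hρK t ht x hx, sub_self]
  have hηslab := h.density.sub_const ρbar
  have hc : ContinuousOn (relativeMass ρbar ρ) (Icc 0 T) := hηslab.continuousOn_integral hK hηK
  have hd : ∀ t ∈ Ioo 0 T, HasDerivAt (relativeMass ρbar ρ) 0 t := by
    intro t ht
    have ht' := Ioo_subset_Icc_self ht
    have hbal := (integrable_and_hasDerivAt_integral_of_balance (s := fun _ => 0)
      (q := fun k x => ρ t x * v t x k) hK ht hηslab hηK
      (fun k => (h.density.mul (h.velocity k)).contDiff ht')
      (fun k x hx => by simp [hvK t ht' x hx]) fun x => ?_).2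
    · rwa [integral_zero] at hbal
    · rw [partialT_eq_of_hasDerivAt ht ((h.density.hasDerivAt_partialT ht x).sub_const ρbar)]
      simp only [partialX_mul (h.density.differentiable ht' x)
        ((h.velocity _).differentiable ht' x)]
      exact h.mass_expanded ht' x
  have h1 := nonpos_of_deriv_le_mul (C := 0) (E := fun t => relativeMass ρbar ρ t
    - relativeMass ρbar ρ 0) (hc.sub continuousOn_const) (fun t ht => (hd t ht).sub_const _)
    (by simp) (by simp) ht
  have h2 := nonpos_of_deriv_le_mul (C := 0) (E := fun t => relativeMass ρbar ρ 0
    - relativeMass ρbar ρ t) (continuousOn_const.sub hc) (fun t ht => (hd t ht).const_sub _)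
    (by simp) (by simp) ht
  linarith

/-- The total bulk stress solves `τ G' = -G`; in particular it keeps its sign. -/
theorem IsC1Solution.bulkIntegral_nonneg (h : IsC1Solution A γ τ ζ T ρ v bulk) (hτ : 0 < τ)
    (hK : IsCompact K) (hvK : ∀ t ∈ Icc 0 T, ∀ x ∉ K, v t x = 0)
    (hbK : ∀ t ∈ Icc 0 T, ∀ x ∉ K, bulk t x = 0) (h0 : 0 ≤ bulkIntegral bulk 0)
    {t : ℝ} (ht : t ∈ Icc 0 T) : 0 ≤ bulkIntegral bulk t := by
  have hc : ContinuousOn (bulkIntegral bulk) (Icc 0 T) :=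
    h.bulkStress.continuousOn_integral hK hbK
  have hd : ∀ t ∈ Ioo 0 T, HasDerivAt (bulkIntegral bulk) (-(1 / τ) * bulkIntegral bulk t) t := by
    intro t ht
    have ht' := Ioo_subset_Icc_self ht
    have hbal := (integrable_and_hasDerivAt_integral_of_balance
      (s := fun x => -(1 / τ) * bulk t x)
      (q := fun k x => bulk t x * v t x k + ζ / τ * v t x k) hK ht h.bulkStress hbK
      (fun k => ((h.bulkStress.mul (h.velocity k)).add
        ((h.velocity k).const_mul (ζ / τ))).contDiff ht')
      (fun k x hx => by simp [hvK t ht' x hx]) fun x => ?_).2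
    · rwa [integral_const_mul] at hbal
    · have fb := h.bulkStress.differentiable ht' x
      have fv := fun k => (h.velocity k).differentiable ht' x
      have e : ∀ k, partialX k (fun y => bulk t y * v t y k + ζ / τ * v t y k) x
          = bulk t x * partialX k (fun y => v t y k) x + v t x k * partialX k (bulk t) x
            + ζ / τ * partialX k (fun y => v t y k) x := by
        intro k
        rw [partialX_add (fb.fun_mul (fv k)) ((fv k).const_mul _), partialX_mul fb (fv k),
          partialX_mul (by fun_prop) (fv k), partialX_const]
        ring
      have hrel := h.relaxation_expanded ht' x
      simp only [e, Fin.sum_univ_three] at hrel ⊢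
      field_simp
      linear_combination hrel
  have h1 := nonpos_of_deriv_le_mul (C := -(1 / τ)) (E := fun t => -bulkIntegral bulk t)
    hc.neg (fun t ht => (hd t ht).neg) (fun t _ => by simp) (by simpa using h0) ht
  linarith

/-- The evolution of the radial momentum, `F' = ∫ (ρ |v|² + 3 (P(ρ) - P(ρbar)) + 3 Π)`. -/
theorem IsC1Solution.hasDerivAt_radialMomentum (h : IsC1Solution A γ τ ζ T ρ v bulk)
    (hA : 0 < A) (hγ : 1 < γ) (hK : IsCompact K)
    (hρK : ∀ t ∈ Icc 0 T, ∀ x ∉ K, ρ t x = ρbar) (hvK : ∀ t ∈ Icc 0 T, ∀ x ∉ K, v t x = 0)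
    (hbK : ∀ t ∈ Icc 0 T, ∀ x ∉ K, bulk t x = 0) (hρ0 : ∀ t ∈ Icc 0 T, ∀ x, 0 ≤ ρ t x)
    {t : ℝ} (ht : t ∈ Ioo 0 T) :
    Integrable (fun x => ρ t x * ∑ i, v t x i ^ 2
      + 3 * (pressure A γ (ρ t x) - pressure A γ ρbar) + 3 * bulk t x) ∧
    HasDerivAt (radialMomentum ρ v) (∫ x, (ρ t x * ∑ i, v t x i ^ 2
      + 3 * (pressure A γ (ρ t x) - pressure A γ ρbar) + 3 * bulk t x)) t := by
  have ht' := Ioo_subset_Icc_self ht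
  have hcoord : ∀ i : Fin 3, IsC1Slab T fun _ x => x i := fun i =>
    isC1Slab_of_contDiff (by fun_prop) T
  refine integrable_and_hasDerivAt_integral_of_balance
    (η := fun t x => ∑ i : Fin 3, x i * (ρ t x * v t x i))
    (q := fun k x => (∑ i : Fin 3, x i * (ρ t x * v t x i)) * v t x k
      + x k * (pressure A γ (ρ t x) - pressure A γ ρbar + bulk t x)) hK ht
    (IsC1Slab.sum fun i => (hcoord i).mul (h.density.mul (h.velocity i)))
    (fun t ht x hx => by simp [hvK t ht x hx])
    (fun k => (((IsC1Slab.sum fun i => (hcoord i).mul (h.density.mul (h.velocity i))).mul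
      (h.velocity k)).add ((hcoord k).mul (((IsC1Slab.comp (contDiff_pressure A hγ)
        h.density).sub_const _).add h.bulkStress))).contDiff ht')
    (fun k x hx => by simp [hvK t ht' x hx, hρK t ht' x hx, hbK t ht' x hx]) fun x => ?_
  have dt : HasDerivAt (fun s => ∑ i : Fin 3, x i * (ρ s x * v s x i))
      (∑ i : Fin 3, x i * (partialT T ρ t x * v t x i
        + ρ t x * partialT T (fun s y => v s y i) t x)) t :=
    HasDerivAt.fun_sum fun i _ => (((h.density.hasDerivAt_partialT ht x).mul
      ((h.velocity i).hasDerivAt_partialT ht x)).const_mul (x i))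
  rw [partialT_eq_of_hasDerivAt ht dt]
  have fρ := h.density.differentiable ht' x
  have fb := h.bulkStress.differentiable ht' x
  have fv := fun k => (h.velocity k).differentiable ht' x
  have fx : ∀ k : Fin 3, DifferentiableAt ℝ (fun y : E3 => y k) x := fun k => by fun_prop
  have fP : DifferentiableAt ℝ (fun y => pressure A γ (ρ t y)) x :=
    (hasDerivAt_pressure hγ (ρ t x)).differentiableAt.comp x fρ
  have e1 : ∀ i k : Fin 3, partialX k (fun y => y i * (ρ t y * v t y i)) x
      = x i * (ρ t x * partialX k (fun y => v t y i) x + v t x i * partialX k (ρ t) x)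
        + ρ t x * v t x i * if i = k then 1 else 0 := by
    intro i k
    rw [partialX_mul (fx i) (fρ.fun_mul (fv i)), partialX_mul fρ (fv i), partialX_coord]
  have e2 : ∀ k, partialX k (fun y => pressure A γ (ρ t y) - pressure A γ ρbar + bulk t y) x
      = soundSpeed A γ (ρ t x) ^ 2 * partialX k (ρ t) x + partialX k (bulk t) x := by
    intro k
    rw [partialX_add (fP.sub_const _) fb, partialX_sub_const,
      partialX_comp (hasDerivAt_pressure hγ (ρ t x)) fρ,
      soundSpeed_sq_of_nonneg hA hγ (hρ0 t ht' x)]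
  have fsum : DifferentiableAt ℝ (fun y => ∑ i : Fin 3, y i * (ρ t y * v t y i)) x :=
    DifferentiableAt.fun_sum fun i _ => (fx i).fun_mul (fρ.fun_mul (fv i))
  have e3 : ∀ k, partialX k (fun y => (∑ i : Fin 3, y i * (ρ t y * v t y i)) * v t y k
      + y k * (pressure A γ (ρ t y) - pressure A γ ρbar + bulk t y)) x
      = (∑ i : Fin 3, x i * (ρ t x * v t x i)) * partialX k (fun y => v t y k) x
        + v t x k * (∑ i : Fin 3, (x i * (ρ t x * partialX k (fun y => v t y i) x
          + v t x i * partialX k (ρ t) x) + ρ t x * v t x i * if i = k then 1 else 0))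
        + (x k * (soundSpeed A γ (ρ t x) ^ 2 * partialX k (ρ t) x + partialX k (bulk t) x)
        + (pressure A γ (ρ t x) - pressure A γ ρbar + bulk t x)) := by
    intro k
    rw [partialX_add (fsum.fun_mul (fv k)) ((fx k).fun_mul ((fP.sub_const _).fun_add fb)),
      partialX_mul fsum (fv k), partialX_mul (fx k) ((fP.sub_const _).fun_add fb), e2,
      partialX_sum fun i => (fx i).fun_mul (fρ.fun_mul (fv i)), partialX_coord]
    simp only [e1, if_true, mul_one]
  simp only [e3]
  have hmass := h.mass_expanded ht' x
  have m0 := h.momentum t ht' x 0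
  have m1 := h.momentum t ht' x 1
  have m2 := h.momentum t ht' x 2
  simp only [Fin.sum_univ_three] at hmass m0 m1 m2 ⊢
  simp only [if_true, if_false, Fin.reduceEq]
  linear_combination (x 0 * v t x 0 + x 1 * v t x 1 + x 2 * v t x 2) * hmass
    + x 0 * m0 + x 1 * m1 + x 2 * m2

theorem measureReal_closedBall_E3 {r : ℝ} (hr : 0 ≤ r) :
    (volume : Measure E3).real (Metric.closedBall 0 r) = 4 * Real.pi / 3 * r ^ 3 := by
  rw [Measure.real, EuclideanSpace.volume_closedBall_fin_three, ENNReal.toReal_mul,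
    ENNReal.toReal_pow, ENNReal.toReal_ofReal hr, ENNReal.toReal_ofReal (by positivity)]
  ring

/-- The total relative mass is controlled by the supremum of the density. -/
theorem relativeMass_le {r m : ℝ} (hr : 0 ≤ r) {t : ℝ} (hρ : Continuous (ρ t))
    (hout : ∀ x ∉ Metric.closedBall (0 : E3) r, ρ t x = ρbar) (hm : ∀ x, ρ t x ≤ m) :
    relativeMass ρbar ρ t ≤ (m - ρbar) * (4 * Real.pi / 3 * r ^ 3) := by
  have hK : IsCompact (Metric.closedBall (0 : E3) r) := isCompact_closedBall _ _
  calc relativeMass ρbar ρ t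
      ≤ ∫ x : E3, (Metric.closedBall (0 : E3) r).indicator (fun _ => m - ρbar) x := by
        refine integral_mono (integrable_of_eqOn_compl hK (by fun_prop)
          fun x hx => by rw [hout x hx, sub_self])
          ((integrable_indicator_iff hK.measurableSet).2
            (integrableOn_const hK.measure_ne_top)) fun x => ?_
        by_cases hx : x ∈ Metric.closedBall (0 : E3) r
        · simp only [indicator_of_mem hx]; linarith [hm x]
        · simp [indicator_of_notMem hx, hout x hx]
    _ = (m - ρbar) * (4 * Real.pi / 3 * r ^ 3) := by
        rw [integral_indicator hK.measurableSet, setIntegral_const, measureReal_closedBall_E3 hr,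
          smul_eq_mul, mul_comm]

/-- The Cauchy–Schwarz inequality, in the form `∫ ρ |v|² ≥ 2 l F - l² ∫ ρ |x|²` for every `l`,
combined with the convexity of the pressure. -/
theorem le_integral_momentum_source {r m t : ℝ} (hA : 0 < A) (hγ : 1 < γ) (hρbar : 0 < ρbar)
    (hr : 0 < r) (hm : ρbar ≤ m) (hρc : Continuous (ρ t))
    (hvc : ∀ i, Continuous fun x => v t x i) (hbc : Continuous (bulk t))
    (hout : ∀ x ∉ Metric.closedBall (0 : E3) r, ρ t x = ρbar ∧ v t x = 0 ∧ bulk t x = 0)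
    (hρ0 : ∀ x, 0 ≤ ρ t x) (hM0 : 0 ≤ relativeMass ρbar ρ t)
    (hM : relativeMass ρbar ρ t ≤ (m - ρbar) * (4 * Real.pi / 3 * r ^ 3))
    (hG : 0 ≤ bulkIntegral bulk t)
    (hint : Integrable (fun x => ρ t x * ∑ i, v t x i ^ 2
      + 3 * (pressure A γ (ρ t x) - pressure A γ ρbar) + 3 * bulk t x)) :
    radialMomentum ρ v t ^ 2 / (4 * Real.pi / 3 * m * r ^ 5) ≤ ∫ x, (ρ t x * ∑ i, v t x i ^ 2
      + 3 * (pressure A γ (ρ t x) - pressure A γ ρbar) + 3 * bulk t x) := by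
  set K := Metric.closedBall (0 : E3) r with hK_def
  have hK : IsCompact K := isCompact_closedBall _ _
  set p' := A * ρbar ^ γ * γ / ρbar with hp'
  have hp'0 : 0 ≤ p' := by
    have := Real.rpow_nonneg hρbar.le γ
    positivity
  set F := radialMomentum ρ v t with hF
  set M := relativeMass ρbar ρ t with hM_def
  set G := bulkIntegral bulk t with hG_def
  set κ := 4 * Real.pi / 3 * m * r ^ 5 with hκ
  have hm0 : 0 < m := hρbar.trans_le hm
  have hκ0 : 0 < κ := by positivity
  set l := F / κ with hl
  have i1 : Integrable fun x : E3 => ∑ i : Fin 3, x i * (ρ t x * v t x i) :=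
    integrable_of_eqOn_compl hK (continuous_finsetSum _ fun i _ =>
      (by fun_prop : Continuous fun x : E3 => x i).mul (hρc.mul (hvc i)))
      fun x hx => by simp [(hout x hx).2.1]
  have i2 : Integrable fun x : E3 => ρ t x - ρbar :=
    integrable_of_eqOn_compl hK (by fun_prop) fun x hx => by rw [(hout x hx).1, sub_self]
  have i3 : Integrable fun x : E3 => K.indicator (fun _ => ρbar) x :=
    (integrable_indicator_iff hK.measurableSet).2 (integrableOn_const hK.measure_ne_top)
  have i4 : Integrable (bulk t) :=
    integrable_of_eqOn_compl hK hbc fun x hx => (hout x hx).2.2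
  have hvol : ∫ x, K.indicator (fun _ => ρbar) x = ρbar * (4 * Real.pi / 3 * r ^ 3) := by
    rw [integral_indicator hK.measurableSet, setIntegral_const, measureReal_closedBall_E3 hr.le,
      smul_eq_mul, mul_comm]
  have j1 := i1.const_mul (2 * l)
  have j2 := i2.const_mul (3 * p' - l ^ 2 * r ^ 2)
  have j3 := i3.const_mul (l ^ 2 * r ^ 2)
  have j4 := i4.const_mul 3
  have j12 := j1.fun_add j2
  have j123 : Integrable fun x : E3 => 2 * l * (∑ i : Fin 3, x i * (ρ t x * v t x i))
      + (3 * p' - l ^ 2 * r ^ 2) * (ρ t x - ρbar)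
      - l ^ 2 * r ^ 2 * K.indicator (fun _ => ρbar) x := j12.sub j3
  have hmono : ∫ x, (2 * l * (∑ i : Fin 3, x i * (ρ t x * v t x i))
      + (3 * p' - l ^ 2 * r ^ 2) * (ρ t x - ρbar) - l ^ 2 * r ^ 2 * K.indicator (fun _ => ρbar) x
      + 3 * bulk t x) ≤ ∫ x, (ρ t x * ∑ i, v t x i ^ 2
      + 3 * (pressure A γ (ρ t x) - pressure A γ ρbar) + 3 * bulk t x) := by
    refine integral_mono (j123.add j4) hint fun x => ?_
    have htan := tangent_le_pressure hA hγ hρbar (hρ0 x)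
    by_cases hx : x ∈ K
    · have hxr : ∑ i, x i ^ 2 ≤ r ^ 2 := by
        rw [← EuclideanSpace.real_norm_sq_eq]
        rw [hK_def, mem_closedBall_zero_iff] at hx
        gcongr
      have hsq : 0 ≤ ρ t x * ((v t x 0 - l * x 0) ^ 2 + (v t x 1 - l * x 1) ^ 2
          + (v t x 2 - l * x 2) ^ 2) := mul_nonneg (hρ0 x) (by positivity)
      have h2 := mul_le_mul_of_nonneg_left hxr (mul_nonneg (hρ0 x) (sq_nonneg l))
      simp only [indicator_of_mem hx, Fin.sum_univ_three] at h2 ⊢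
      linarith
    · obtain ⟨h1, h2, h3⟩ := hout x hx
      simp [indicator_of_notMem hx, h1, h2, h3]
  have hval : ∫ x, (2 * l * (∑ i : Fin 3, x i * (ρ t x * v t x i))
      + (3 * p' - l ^ 2 * r ^ 2) * (ρ t x - ρbar) - l ^ 2 * r ^ 2 * K.indicator (fun _ => ρbar) x
      + 3 * bulk t x) = 2 * l * F + (3 * p' - l ^ 2 * r ^ 2) * M
        - l ^ 2 * r ^ 2 * (ρbar * (4 * Real.pi / 3 * r ^ 3)) + 3 * G := by
    rw [integral_add j123 j4, integral_sub j12 j3, integral_add j1 j2,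
      integral_const_mul, integral_const_mul,
      integral_const_mul, integral_const_mul, hvol]
    rfl
  rw [hval] at hmono
  refine le_trans ?_ hmono
  have hlF : F ^ 2 / κ = 2 * l * F - l ^ 2 * κ := by
    rw [hl]; field_simp; ring
  have h1 := mul_le_mul_of_nonneg_left hM (by positivity : 0 ≤ l ^ 2 * r ^ 2)
  have h2 : 0 ≤ p' * M := mul_nonneg hp'0 hM0
  have h3 : l ^ 2 * κ = l ^ 2 * r ^ 2 * ((m - ρbar) * (4 * Real.pi / 3 * r ^ 3))
      + l ^ 2 * r ^ 2 * (ρbar * (4 * Real.pi / 3 * r ^ 3)) := by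
    rw [hκ]; ring
  rw [hlF]
  linarith

end Functionals

/-! ### Blow-up of the radial momentum -/

/-- A function with `F' ≥ F² / (κ (R + c t)⁵)` and `F 0 > 4 c κ R⁴` blows up before an explicit
time. -/
theorem le_of_riccati {F F' : ℝ → ℝ} {T R c κ : ℝ} (hT : 0 < T) (hR : 0 < R) (hc : 0 < c)
    (hκ : 0 < κ) (hcont : ContinuousOn F (Icc 0 T))
    (hd : ∀ t ∈ Ioo 0 T, HasDerivAt F (F' t) t)
    (hle : ∀ t ∈ Ioo 0 T, F t ^ 2 / (κ * (R + c * t) ^ 5) ≤ F' t)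
    (h0 : 4 * c * κ * R ^ 4 < F 0) :
    T ≤ 1 / (4 * c ^ 2 * κ * (1 / (4 * c * κ * R ^ 4) - 1 / F 0) * R ^ 3) := by
  have hF0 : 0 < F 0 := lt_trans (by positivity) h0
  have hRt : ∀ t ∈ Icc 0 T, 0 < R + c * t := fun t ht => by
    have := mul_nonneg hc.le ht.1
    linarith
  have hmono : MonotoneOn F (Icc 0 T) := by
    refine monotoneOn_of_deriv_nonneg (convex_Icc 0 T) hcont ?_ ?_ <;> rw [interior_Icc]
    · exact fun t ht => (hd t ht).differentiableAt.differentiableWithinAt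
    · intro t ht
      rw [(hd t ht).deriv]
      have := hRt t (Ioo_subset_Icc_self ht)
      exact le_trans (by positivity) (hle t ht)
  have hpos : ∀ t ∈ Icc 0 T, 0 < F t := fun t ht =>
    hF0.trans_le (hmono ⟨le_rfl, hT.le⟩ ht ht.1)
  have hder : ∀ t ∈ Ioo 0 T,
      HasDerivAt (fun t => (F t)⁻¹ - 1 / (4 * c * κ) * ((R + c * t) ^ 4)⁻¹)
        (-F' t / F t ^ 2 - 1 / (4 * c * κ) * (-(4 * (R + c * t) ^ 3 * c)
          / ((R + c * t) ^ 4) ^ 2)) t := by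
    intro t ht
    have ht' := Ioo_subset_Icc_self ht
    have h1 : HasDerivAt (fun t => (R + c * t) ^ 4) (4 * (R + c * t) ^ 3 * c) t := by
      simpa using (((hasDerivAt_id t).const_mul c).const_add R).fun_pow 4
    exact ((hd t ht).inv (hpos t ht').ne').sub
      ((h1.inv (pow_pos (hRt t ht') 4).ne').const_mul _)
  have hanti : AntitoneOn (fun t => (F t)⁻¹ - 1 / (4 * c * κ) * ((R + c * t) ^ 4)⁻¹)
      (Icc 0 T) := by
    refine antitoneOn_of_deriv_nonpos (convex_Icc 0 T)
      ((hcont.inv₀ fun t ht => (hpos t ht).ne').sub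
        (continuousOn_const.mul (ContinuousOn.inv₀ (by fun_prop)
          fun t ht => (pow_pos (hRt t ht) 4).ne'))) ?_ ?_ <;> rw [interior_Icc]
    · exact fun t ht => (hder t ht).differentiableAt.differentiableWithinAt
    · intro t ht
      have ht' := Ioo_subset_Icc_self ht
      have hF := hpos t ht'
      have hS := hRt t ht'
      rw [(hder t ht).deriv]
      have h1 : 1 / (κ * (R + c * t) ^ 5) ≤ F' t / F t ^ 2 := by
        rw [le_div_iff₀ (by positivity), one_div_mul_eq_div]
        exact hle t ht
      have h2 : 1 / (4 * c * κ) * (-(4 * (R + c * t) ^ 3 * c) / ((R + c * t) ^ 4) ^ 2)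
          = -(1 / (κ * (R + c * t) ^ 5)) := by
        field_simp
      rw [h2, neg_div]
      linarith
  have hfin := hanti ⟨le_rfl, hT.le⟩ ⟨hT.le, le_rfl⟩ hT.le
  simp only [mul_zero, add_zero] at hfin
  have hFT : 0 < (F T)⁻¹ := inv_pos.2 (hpos T ⟨hT.le, le_rfl⟩)
  set δ := 1 / (4 * c * κ * R ^ 4) - 1 / F 0 with hδ
  have hδ0 : 0 < δ := sub_pos.2 (one_div_lt_one_div_of_lt (by positivity) h0)
  have hS := hRt T ⟨hT.le, le_rfl⟩
  have h1 : δ < 1 / (4 * c * κ * (R + c * T) ^ 4) := by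
    have e1 : 1 / (4 * c * κ * R ^ 4) = 1 / (4 * c * κ) * (R ^ 4)⁻¹ := by field_simp
    have e2 : 1 / (4 * c * κ * (R + c * T) ^ 4) = 1 / (4 * c * κ) * ((R + c * T) ^ 4)⁻¹ := by
      field_simp
    rw [hδ, e1, e2, one_div (F 0)]
    linarith
  rw [lt_div_iff₀ (by positivity)] at h1
  rw [le_div_iff₀ (by positivity)]
  have h2 : R ^ 3 * (c * T) ≤ (R + c * T) ^ 4 := by
    have hcT : 0 ≤ c * T := by positivity
    calc R ^ 3 * (c * T) ≤ (R + c * T) ^ 3 * (R + c * T) :=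
          mul_le_mul (pow_le_pow_left₀ hR.le (by linarith) 3) (by linarith) hcT (by positivity)
      _ = _ := by ring
  have h3 := mul_le_mul_of_nonneg_left h2 (by positivity : 0 ≤ 4 * c * κ * δ)
  linarith

/-- The existence time of a `C¹` solution is bounded in terms of the data. -/
theorem IsC1Solution.time_le {A γ τ ζ T ρbar R m : ℝ} {ρ : ℝ → E3 → ℝ} {v : ℝ → E3 → E3}
    {bulk : ℝ → E3 → ℝ} (h : IsC1Solution A γ τ ζ T ρ v bulk) (hA : 0 < A) (hγ : 1 < γ)
    (hτ : 0 < τ) (hζ : 0 < ζ) (hρbar : 0 < ρbar) (hR : 0 < R) (hT : 0 < T)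
    (hρ0 : ∀ x, 0 ≤ ρ 0 x)
    (hinit : ∀ x, R ≤ ‖x‖ → ρ 0 x = ρbar ∧ v 0 x = 0 ∧ bulk 0 x = 0)
    (hm : ∀ x, ρ 0 x ≤ m) (hmbar : ρbar ≤ m)
    (hM : 0 ≤ relativeMass ρbar ρ 0)
    (hF : 4 * frontSpeed A γ τ ζ ρbar * (4 * Real.pi / 3 * m) * R ^ 4 < radialMomentum ρ v 0)
    (hG : 0 ≤ bulkIntegral bulk 0) :
    T ≤ 1 / (4 * frontSpeed A γ τ ζ ρbar ^ 2 * (4 * Real.pi / 3 * m)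
      * (1 / (4 * frontSpeed A γ τ ζ ρbar * (4 * Real.pi / 3 * m) * R ^ 4)
        - 1 / radialMomentum ρ v 0) * R ^ 3) := by
  have hprop := fun {t : ℝ} (ht : t ∈ Icc 0 T) {x : E3} =>
    h.eq_rest_outside hA hγ hτ hζ hρbar hinit ht (x := x)
  have hc := frontSpeed_pos (A := A) (γ := γ) hτ hζ hρbar
  set c := frontSpeed A γ τ ζ ρbar with hc_def
  set K := Metric.closedBall (0 : E3) (R + c * T) with hK_def
  have hK : IsCompact K := isCompact_closedBall _ _
  have hsub : ∀ t ∈ Icc 0 T, Metric.closedBall (0 : E3) (R + c * t) ⊆ K := fun t ht =>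
    Metric.closedBall_subset_closedBall (by
      have := mul_le_mul_of_nonneg_left ht.2 hc.le
      linarith)
  have hout : ∀ t ∈ Icc 0 T, ∀ x ∉ K, ρ t x = ρbar ∧ v t x = 0 ∧ bulk t x = 0 :=
    fun t ht x hx => hprop ht fun hx' => hx (hsub t ht hx')
  have hρK : ∀ t ∈ Icc 0 T, ∀ x ∉ K, ρ t x = ρbar := fun t ht x hx => (hout t ht x hx).1
  have hvK : ∀ t ∈ Icc 0 T, ∀ x ∉ K, v t x = 0 := fun t ht x hx => (hout t ht x hx).2.1
  have hbK : ∀ t ∈ Icc 0 T, ∀ x ∉ K, bulk t x = 0 := fun t ht x hx => (hout t ht x hx).2.2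
  have hρnn : ∀ t ∈ Icc 0 T, ∀ x, 0 ≤ ρ t x := fun t ht x =>
    h.density_nonneg hT hρbar hK hρK hρ0 ht x
  have h0mem : (0 : ℝ) ∈ Icc 0 T := ⟨le_rfl, hT.le⟩
  have hm0 : 0 < m := hρbar.trans_le hmbar
  have hM0 : relativeMass ρbar ρ 0 ≤ (m - ρbar) * (4 * Real.pi / 3 * R ^ 3) :=
    relativeMass_le hR.le (h.density.contDiff h0mem).continuous
      (fun x hx => (hprop h0mem (by simpa using hx)).1) hm
  have hd := fun t (ht : t ∈ Ioo 0 T) =>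
    h.hasDerivAt_radialMomentum hA hγ hK hρK hvK hbK hρnn ht
  have hslab : IsC1Slab T fun t x => ∑ i : Fin 3, x i * (ρ t x * v t x i) :=
    IsC1Slab.sum fun i => (isC1Slab_of_contDiff (f := fun _ x => x i) (by fun_prop) T).mul
      (h.density.mul (h.velocity i))
  refine le_of_riccati hT hR hc (by positivity)
    (hslab.continuousOn_integral hK fun t ht x hx => by simp [hvK t ht x hx])
    (fun t ht => (hd t ht).2) (fun t ht => ?_) hF
  have ht' := Ioo_subset_Icc_self ht
  have hct : 0 ≤ c * t := mul_nonneg hc.le ht'.1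
  have hMt := h.relativeMass_eq hK hρK hvK ht'
  refine le_integral_momentum_source hA hγ hρbar (by linarith) hmbar
    (h.density.contDiff ht').continuous (fun i => ((h.velocity i).contDiff ht').continuous)
    (h.bulkStress.contDiff ht').continuous (fun x hx => hprop ht' hx) (hρnn t ht') (hMt ▸ hM) ?_
    (h.bulkIntegral_nonneg hτ hK hvK hbK hG ht') (hd t ht).1
  rw [hMt]
  refine hM0.trans (mul_le_mul_of_nonneg_left ?_ (by linarith))
  gcongr
  linarith

end BulkViscous

theorem theorem2
    (A γ τ ζ ρbar R T₀ : ℝ)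
    (hA : 0 < A) (hγ : 1 < γ) (hτ : 0 < τ) (hζ : 0 < ζ)
    (hρbar : 0 < ρbar) (hR : 0 < R) (hT₀ : 0 < T₀)
    (ρ : ℝ → BulkViscous.E3 → ℝ) (v : ℝ → BulkViscous.E3 → BulkViscous.E3)
    (bulk : ℝ → BulkViscous.E3 → ℝ)
    (hsol : BulkViscous.IsC1Solution A γ τ ζ T₀ ρ v bulk)
    (hρ_pos : ∀ x, 0 < ρ 0 x)
    (hρ_out : ∀ x, R ≤ ‖x‖ → ρ 0 x = ρbar)
    (hv_out : ∀ x, R ≤ ‖x‖ → v 0 x = 0)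
    (hbulk_out : ∀ x, R ≤ ‖x‖ → bulk 0 x = 0)
    (hM : 0 ≤ BulkViscous.relativeMass ρbar ρ 0)
    (hF : 16 * Real.pi / 3 * BulkViscous.frontSpeed A γ τ ζ ρbar * R ^ 4 * (⨆ x, ρ 0 x)
      < BulkViscous.radialMomentum ρ v 0)
    (hG : 0 ≤ BulkViscous.bulkIntegral bulk 0) :
    BulkViscous.lifespan A γ τ ζ (ρ 0) (v 0) (bulk 0) < ⊤ := by
  have hcont : Continuous (ρ 0) := (hsol.density.contDiff ⟨le_rfl, hT₀.le⟩).continuous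
  -- The supremum is a genuine one: the density is bounded.
  have hbdd : BddAbove (range (ρ 0)) := by
    obtain ⟨B, hB⟩ := (isCompact_closedBall (0 : BulkViscous.E3) R).bddAbove_image
      hcont.continuousOn
    refine ⟨max B ρbar, ?_⟩
    rintro _ ⟨x, rfl⟩
    rcases le_total R ‖x‖ with hx | hx
    · exact (hρ_out x hx).trans_le (le_max_right _ _)
    · exact (hB ⟨x, by simpa using hx, rfl⟩).trans (le_max_left _ _)
  set m := ⨆ x, ρ 0 x with hm_def
  have hm : ∀ x, ρ 0 x ≤ m := fun x => le_ciSup hbdd x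
  have hmbar : ρbar ≤ m := by
    have hx : R ≤ ‖(EuclideanSpace.single 0 R : BulkViscous.E3)‖ := by simp [abs_of_pos hR]
    exact (hρ_out _ hx).symm.trans_le (hm _)
  set c := BulkViscous.frontSpeed A γ τ ζ ρbar
  refine lt_of_le_of_lt (b := ENNReal.ofReal (1 / (4 * c ^ 2 * (4 * Real.pi / 3 * m)
    * (1 / (4 * c * (4 * Real.pi / 3 * m) * R ^ 4) - 1 / BulkViscous.radialMomentum ρ v 0)
    * R ^ 3))) (sSup_le ?_) ENNReal.ofReal_lt_top
  rintro _ ⟨T, ⟨hT, ρ', v', bulk', h', hρ', hv', hb'⟩, rfl⟩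
  have eF : BulkViscous.radialMomentum ρ' v' 0 = BulkViscous.radialMomentum ρ v 0 := by
    simp only [BulkViscous.radialMomentum, hρ', hv']
  have eM : BulkViscous.relativeMass ρbar ρ' 0 = BulkViscous.relativeMass ρbar ρ 0 := by
    simp only [BulkViscous.relativeMass, hρ']
  have eG : BulkViscous.bulkIntegral bulk' 0 = BulkViscous.bulkIntegral bulk 0 := by
    simp only [BulkViscous.bulkIntegral, hb']
  have hle := h'.time_le hA hγ hτ hζ hρbar hR hT (m := m)
    (fun x => by rw [hρ']; exact (hρ_pos x).le)
    (fun x hx => ⟨by rw [hρ']; exact hρ_out x hx, by rw [hv']; exact hv_out x hx,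
      by rw [hb']; exact hbulk_out x hx⟩)
    (fun x => by rw [hρ']; exact hm x) hmbar (eM ▸ hM) (by rw [eF]; linarith) (eG ▸ hG)
  rw [eF] at hle
  exact ENNReal.ofReal_le_ofReal hle
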